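/- Let $k$ be a field. All coalgebras are coassociative and counital over $k$. A right coideal of a coalgebra $C$ is a subspace $N\subseteq C$ with $\Delta(N)\subseteq N\otimes C$; right coideals form a lattice under sum and intersection. $C$ is a chain coalgebra if $C\neq 0$ and this lattice is a chain, and $C$ is distributive if this lattice is distributive. $C$ is pointed if every simple subcoalgebra of $C$ is one-dimensional. The divided power coalgebra $\mathcal{DC}$ over $k$ has basis $\{c_n : n\in\mathbb N\}$, where $\mathbb N=\{0,1,2,\dots\}$, with $\Delta(c_n)=\sum_{i=0}^n c_i\otimes c_{n-i}$ and $\varepsilon(c_n)=\delta_{0,n}$. For a $k$-algebra $A$, let $A^\circ$ be its finite dual coalgebra: the space of linear forms on $A$ vanishing on some two-sided ideal of finite codimension, with $\Delta f=\sum g_i\otimes h_i$ if $f(ab)=\sum g_i(a)h_i(b)$ for all $a,b \in A$, and $\varepsilon(f)=f(1)$; if $A$ is finite-dimensional, then $A^\circ=A^*$. 1. A coalgebra over $k$ is a pointed chain coalgebra if and only if it is isomorphic to a nonzero subcoalgebra of $\mathcal{DC}$. 2. A coalgebra over $k$ is isomorphic to a nonzero subcoalgebra of $\mathcal{DC}$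 if and only if it is isomorphic to $(k[x]/\langle x^n\rangle)^*$ for some integer $n>0$ or to $k[[x]]^\circ$. 3. Suppose that $k$ is algebraically closed. Then a coalgebra over $k$ is a chain coalgebra if and only if it is isomorphic to a nonzero subcoalgebra of $\mathcal{DC}$, and it is distributive if and only if it is isomorphic to a coproduct (direct sum, over a possibly empty index set) of nonzero subcoalgebras of $\mathcal{DC}$. -/

import Mathlib

open scoped TensorProduct

universe u v

noncomputable section

/-! ### Tensor products over a field -/

namespace CoalgTensor

variable {k : Type u} [Field k]

/-- A tensor `z ∈ M ⊗ C` lies in `N ⊗ C` iff all its slices `(id ⊗ f) z` lie in `N`. -/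
theorem mem_range_rTensor_iff {M C : Type*} [AddCommGroup M] [Module k M] [AddCommGroup C]
    [Module k C] (N : Submodule k M) (z : M ⊗[k] C) :
    z ∈ LinearMap.range (LinearMap.rTensor C N.subtype) ↔
      ∀ f : C →ₗ[k] k, TensorProduct.rid k M (LinearMap.lTensor M f z) ∈ N := by
  classical
  constructor
  · rintro ⟨t, rfl⟩ f
    induction t using TensorProduct.induction_on with
    | zero => simp
    | tmul x y => simpa using N.smul_mem _ x.2
    | add x y hx hy => simpa using N.add_mem hx hy
  · intro h
    let b := Module.Basis.ofVectorSpace k C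
    have key : z = (TensorProduct.equivFinsuppOfBasisRight b z).sum
        fun i m => m ⊗ₜ[k] b i := by
      conv_lhs => rw [← (TensorProduct.equivFinsuppOfBasisRight (M := M) b).symm_apply_apply z]
      rw [TensorProduct.equivFinsuppOfBasisRight_symm_apply]
    have coeff : ∀ (z : M ⊗[k] C) i, TensorProduct.equivFinsuppOfBasisRight b z i =
        TensorProduct.rid k M (LinearMap.lTensor M (b.coord i) z) := by
      intro z i
      induction z using TensorProduct.induction_on with
      | zero => simp
      | tmul x y => simp [TensorProduct.equivFinsuppOfBasisRight_apply_tmul]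
      | add x y hx hy => simp [hx, hy]
    rw [key]
    refine Submodule.sum_mem _ fun i _ => ?_
    refine ⟨(⟨_, ?_⟩ : N) ⊗ₜ[k] b i, by simp; rfl⟩
    rw [coeff]
    exact h _

/-- Over a field, the canonical map `X* ⊗ Y* → (X ⊗ Y)*` is injective. -/
theorem dualDistrib_injective (X Y : Type*) [AddCommGroup X] [Module k X] [AddCommGroup Y]
    [Module k Y] : Function.Injective (TensorProduct.dualDistrib k X Y) := by
  classical
  rw [injective_iff_map_eq_zero]
  intro z hz
  let b := Module.Basis.ofVectorSpace k (Module.Dual k Y)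
  have coeff : ∀ (z : Module.Dual k X ⊗[k] Module.Dual k Y) x y,
      TensorProduct.dualDistrib k X Y z (x ⊗ₜ y) =
      ((TensorProduct.equivFinsuppOfBasisRight b z).sum fun i f => f x • b i) y := by
    intro z x y
    conv_lhs => rw [← (TensorProduct.equivFinsuppOfBasisRight
      (M := Module.Dual k X) b).symm_apply_apply z]
    rw [TensorProduct.equivFinsuppOfBasisRight_symm_apply]
    simp [Finsupp.sum, LinearMap.sum_apply]
  rw [← (TensorProduct.equivFinsuppOfBasisRight (M := Module.Dual k X) b).map_eq_zero_iff]
  ext i x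
  have h0 : ((TensorProduct.equivFinsuppOfBasisRight b z).sum fun i f => f x • b i) = 0 := by
    ext y
    rw [← coeff, hz]
    simp
  have := (linearIndependent_iff'.1 b.linearIndependent) _ _ h0 i
  by_cases hi : i ∈ (TensorProduct.equivFinsuppOfBasisRight b z).support
  · simpa using this hi
  · simp [Finsupp.notMem_support_iff.1 hi]

end CoalgTensor

/-! ### Right coideals, chain coalgebras and distributive coalgebras -/

section Coideals

variable (k : Type u) (C : Type v) [Field k] [AddCommGroup C] [Module k C] [Coalgebra k C]

/-- A right coideal of `C` is a right subcomodule of `C`: a subspace `N` with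
`Δ(N) ⊆ N ⊗ C`. -/
def IsRightCoideal (N : Submodule k C) : Prop :=
  ∀ x ∈ N, (Coalgebra.comul x : C ⊗[k] C) ∈ LinearMap.range (LinearMap.rTensor C N.subtype)

/-- The lattice of right coideals of `C`; join is the sum and meet is the intersection of
subspaces. -/
def rightCoideals : Sublattice (Submodule k C) where
  carrier := {N | IsRightCoideal k C N}
  supClosed' := by
    intro N hN L hL x hx
    rw [CoalgTensor.mem_range_rTensor_iff]
    intro f
    obtain ⟨y, hy, z, hz, rfl⟩ := Submodule.mem_sup.1 hx
    rw [map_add, map_add, map_add]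
    exact Submodule.add_mem_sup ((CoalgTensor.mem_range_rTensor_iff _ _).1 (hN y hy) f)
      ((CoalgTensor.mem_range_rTensor_iff _ _).1 (hL z hz) f)
  infClosed' := by
    intro N hN L hL x hx
    rw [CoalgTensor.mem_range_rTensor_iff]
    exact fun f => ⟨(CoalgTensor.mem_range_rTensor_iff _ _).1 (hN x hx.1) f,
      (CoalgTensor.mem_range_rTensor_iff _ _).1 (hL x hx.2) f⟩

/-- A chain coalgebra is a nonzero coalgebra whose lattice of right coideals is a chain. -/
structure IsChainCoalgebra : Prop where
  nontrivial : Nontrivial C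
  le_or_le : ∀ N L : rightCoideals k C, N ≤ L ∨ L ≤ N

/-- A coalgebra is distributive if its lattice of right coideals is distributive. -/
def IsDistributiveCoalgebra : Prop :=
  ∀ N L M : rightCoideals k C, N ⊓ (L ⊔ M) = (N ⊓ L) ⊔ (N ⊓ M)

end Coideals

/-! ### Subcoalgebras -/

/-- A subcoalgebra of `C` is a subspace `D` with `Δ(D) ⊆ D ⊗ D`. -/
structure Subcoalgebra (k : Type u) (C : Type v) [Field k] [AddCommGroup C] [Module k C]
    [Coalgebra k C] extends Submodule k C where
  comul_mem' : ∀ x ∈ toSubmodule, (Coalgebra.comul x : C ⊗[k] C) ∈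
    LinearMap.range (TensorProduct.map toSubmodule.subtype toSubmodule.subtype)

namespace Subcoalgebra

variable {k : Type u} {C : Type v} [Field k] [AddCommGroup C] [Module k C] [Coalgebra k C]
  (D : Subcoalgebra k C)

theorem map_subtype_injective : Function.Injective
    (TensorProduct.map D.toSubmodule.subtype D.toSubmodule.subtype) :=
  TensorProduct.map_injective_of_flat_flat _ _ D.toSubmodule.injective_subtype
    D.toSubmodule.injective_subtype

/-- The comultiplication of `D`: the restriction of that of `C`. -/
def comulAux : D.toSubmodule →ₗ[k] D.toSubmodule ⊗[k] D.toSubmodule :=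
  (LinearEquiv.ofInjective _ D.map_subtype_injective).symm.toLinearMap ∘ₗ
    LinearMap.codRestrict _ (Coalgebra.comul ∘ₗ D.toSubmodule.subtype)
      fun x => D.comul_mem' x x.2

theorem map_subtype_comulAux (x : D.toSubmodule) :
    TensorProduct.map D.toSubmodule.subtype D.toSubmodule.subtype (D.comulAux x) =
      Coalgebra.comul (x : C) := by
  have := LinearEquiv.apply_symm_apply (LinearEquiv.ofInjective _ D.map_subtype_injective)
    (LinearMap.codRestrict _ (Coalgebra.comul ∘ₗ D.toSubmodule.subtype)
      (fun x => D.comul_mem' x x.2) x)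
  exact congrArg Subtype.val this

theorem map_subtype_comp_comulAux :
    TensorProduct.map D.toSubmodule.subtype D.toSubmodule.subtype ∘ₗ D.comulAux =
      Coalgebra.comul ∘ₗ D.toSubmodule.subtype :=
  LinearMap.ext D.map_subtype_comulAux

instance instCoalgebraStruct : CoalgebraStruct k D.toSubmodule where
  comul := D.comulAux
  counit := Coalgebra.counit ∘ₗ D.toSubmodule.subtype

instance instCoalgebra : Coalgebra k D.toSubmodule where
  coassoc := by
    change _ ∘ₗ LinearMap.rTensor _ D.comulAux ∘ₗ D.comulAux =
      LinearMap.lTensor _ D.comulAux ∘ₗ D.comulAux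
    have hinj := TensorProduct.map_injective_of_flat_flat _ _ D.toSubmodule.injective_subtype
      D.map_subtype_injective
    refine LinearMap.ext fun x => hinj ?_
    have h1 : ∀ z : D.toSubmodule ⊗[k] D.toSubmodule,
        TensorProduct.map D.toSubmodule.subtype
          (TensorProduct.map D.toSubmodule.subtype D.toSubmodule.subtype)
          (TensorProduct.assoc k _ _ _ (LinearMap.rTensor _ D.comulAux z)) =
        TensorProduct.assoc k C C C (LinearMap.rTensor C Coalgebra.comul
          (TensorProduct.map D.toSubmodule.subtype D.toSubmodule.subtype z)) := by
      intro z
      induction z using TensorProduct.induction_on with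
      | zero => simp
      | tmul a b =>
        simp only [LinearMap.rTensor_tmul, TensorProduct.map_tmul, Submodule.subtype_apply]
        rw [← D.map_subtype_comulAux]
        generalize D.comulAux a = t
        induction t using TensorProduct.induction_on with
        | zero => simp
        | tmul a b => simp
        | add x y hx hy => simp [TensorProduct.add_tmul, hx, hy]
      | add x y hx hy => simp only [map_add, hx, hy]
    have h2 : ∀ z : D.toSubmodule ⊗[k] D.toSubmodule,
        TensorProduct.map D.toSubmodule.subtype
          (TensorProduct.map D.toSubmodule.subtype D.toSubmodule.subtype)
          (LinearMap.lTensor _ D.comulAux z) =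
        LinearMap.lTensor C Coalgebra.comul
          (TensorProduct.map D.toSubmodule.subtype D.toSubmodule.subtype z) := by
      intro z
      induction z using TensorProduct.induction_on with
      | zero => simp
      | tmul a b => simp [D.map_subtype_comulAux]
      | add x y hx hy => simp only [map_add, hx, hy]
    simp only [LinearMap.comp_apply, LinearEquiv.coe_coe]
    rw [h1, h2, D.map_subtype_comulAux]
    exact Coalgebra.coassoc_apply _
  rTensor_counit_comp_comul := by
    change LinearMap.rTensor _ (Coalgebra.counit ∘ₗ D.toSubmodule.subtype) ∘ₗ D.comulAux = _
    have hinj : Function.Injective (LinearMap.lTensor k D.toSubmodule.subtype) :=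
      Module.Flat.lTensor_preserves_injective_linearMap _ D.toSubmodule.injective_subtype
    refine LinearMap.ext fun x => hinj ?_
    have h : ∀ z : D.toSubmodule ⊗[k] D.toSubmodule,
        LinearMap.lTensor k D.toSubmodule.subtype
          (LinearMap.rTensor _ (Coalgebra.counit ∘ₗ D.toSubmodule.subtype) z) =
        LinearMap.rTensor C Coalgebra.counit
          (TensorProduct.map D.toSubmodule.subtype D.toSubmodule.subtype z) := by
      intro z
      induction z using TensorProduct.induction_on with
      | zero => simp
      | tmul a b => simp
      | add x y hx hy => simp only [map_add, hx, hy]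
    rw [LinearMap.comp_apply, h, D.map_subtype_comulAux, Coalgebra.rTensor_counit_comul]
    simp
  lTensor_counit_comp_comul := by
    change LinearMap.lTensor _ (Coalgebra.counit ∘ₗ D.toSubmodule.subtype) ∘ₗ D.comulAux = _
    have hinj : Function.Injective (LinearMap.rTensor k D.toSubmodule.subtype) :=
      Module.Flat.rTensor_preserves_injective_linearMap _ D.toSubmodule.injective_subtype
    refine LinearMap.ext fun x => hinj ?_
    have h : ∀ z : D.toSubmodule ⊗[k] D.toSubmodule,
        LinearMap.rTensor k D.toSubmodule.subtype
          (LinearMap.lTensor _ (Coalgebra.counit ∘ₗ D.toSubmodule.subtype) z) =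
        LinearMap.lTensor C Coalgebra.counit
          (TensorProduct.map D.toSubmodule.subtype D.toSubmodule.subtype z) := by
      intro z
      induction z using TensorProduct.induction_on with
      | zero => simp
      | tmul a b => simp
      | add x y hx hy => simp only [map_add, hx, hy]
    rw [LinearMap.comp_apply, h, D.map_subtype_comulAux, Coalgebra.lTensor_counit_comul]
    simp

/-- A subcoalgebra is simple if it is nonzero and its only subcoalgebras (that is, the
subcoalgebras of `C` contained in it) are `0` and itself. -/
def IsSimple : Prop :=
  D.toSubmodule ≠ ⊥ ∧ ∀ E : Subcoalgebra k C, E.toSubmodule ≤ D.toSubmodule →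
    E.toSubmodule = ⊥ ∨ E.toSubmodule = D.toSubmodule

end Subcoalgebra

/-- A coalgebra is pointed if each of its simple subcoalgebras is one-dimensional. -/
def IsPointedCoalgebra (k : Type u) (C : Type v) [Field k] [AddCommGroup C] [Module k C]
    [Coalgebra k C] : Prop :=
  ∀ D : Subcoalgebra k C, D.IsSimple → Module.finrank k D.toSubmodule = 1

/-! ### The divided power coalgebra -/

/-- The underlying space of the divided power coalgebra over `k`, with basis `c 0, c 1, …`. -/
def DividedPower (k : Type u) [Field k] : Type u := ℕ →₀ k

namespace DividedPower

variable (k : Type u) [Field k]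

instance : AddCommGroup (DividedPower k) := inferInstanceAs (AddCommGroup (ℕ →₀ k))

instance : Module k (DividedPower k) := inferInstanceAs (Module k (ℕ →₀ k))

/-- The basis `(c n)` of the divided power coalgebra. -/
def c : Module.Basis ℕ k (DividedPower k) := Module.Basis.ofRepr (LinearEquiv.refl k (ℕ →₀ k))

/-- `Δ (c n) = ∑_{i + j = n} c i ⊗ c j` and `ε (c n) = δ_{0,n}`. -/
instance instCoalgebraStruct : CoalgebraStruct k (DividedPower k) where
  comul := (c k).constr k fun n => ∑ p ∈ Finset.HasAntidiagonal.antidiagonal n, c k p.1 ⊗ₜ[k] c k p.2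
  counit := (c k).constr k fun n => if n = 0 then 1 else 0

theorem comul_c (n : ℕ) : (Coalgebra.comul (c k n) : DividedPower k ⊗[k] DividedPower k) =
    ∑ p ∈ Finset.HasAntidiagonal.antidiagonal n, c k p.1 ⊗ₜ[k] c k p.2 :=
  (c k).constr_basis k _ n

theorem counit_c (n : ℕ) : (Coalgebra.counit (c k n) : k) = if n = 0 then 1 else 0 :=
  (c k).constr_basis k (fun n => if n = 0 then 1 else 0) n

instance instCoalgebra : Coalgebra k (DividedPower k) where
  coassoc := by
    refine (c k).ext fun n => ?_
    simp only [LinearMap.comp_apply, comul_c, map_sum, LinearMap.rTensor_tmul,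
      LinearMap.lTensor_tmul, TensorProduct.sum_tmul, TensorProduct.tmul_sum,
      LinearEquiv.coe_coe, TensorProduct.assoc_tmul]
    rw [Finset.sum_sigma', Finset.sum_sigma']
    refine Finset.sum_nbij' (fun x => ⟨(x.2.1, x.2.2 + x.1.2), (x.2.2, x.1.2)⟩)
      (fun x => ⟨(x.1.1 + x.2.1, x.2.2), (x.1.1, x.2.1)⟩) ?_ ?_ ?_ ?_ ?_
    · rintro ⟨⟨a, b⟩, d, e⟩ h
      simp at h ⊢
      omega
    · rintro ⟨⟨a, b⟩, d, e⟩ h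
      simp at h ⊢
      omega
    · rintro ⟨⟨a, b⟩, d, e⟩ h
      simp at h
      simp [h]
    · rintro ⟨⟨a, b⟩, d, e⟩ h
      simp at h
      simp [h]
    · intro _ _
      rfl
  rTensor_counit_comp_comul := by
    refine (c k).ext fun n => ?_
    simp only [LinearMap.comp_apply, comul_c, map_sum, LinearMap.rTensor_tmul, counit_c]
    rw [Finset.sum_eq_single (0, n)]
    · simp
    · rintro ⟨a, b⟩ h hne
      have : a ≠ 0 := by
        rintro rfl
        simp at h
        simp [h] at hne
      simp [this]
    · simp
  lTensor_counit_comp_comul := by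
    refine (c k).ext fun n => ?_
    simp only [LinearMap.comp_apply, comul_c, map_sum, LinearMap.lTensor_tmul, counit_c]
    rw [Finset.sum_eq_single (n, 0)]
    · simp
    · rintro ⟨a, b⟩ h hne
      have : b ≠ 0 := by
        rintro rfl
        simp at h
        simp [h] at hne
      simp [this]
    · simp

end DividedPower

/-! ### The finite dual of an algebra -/

section FiniteDual

variable (k : Type u) (A : Type v) [Field k] [Ring A] [Algebra k A]

/-- The finite dual `A°` of a `k`-algebra `A`: the linear forms on `A` that vanish on a two-sided
ideal of finite codimension. -/
def finiteDual : Submodule k (Module.Dual k A) where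
  carrier := {f | ∃ I : Ideal A, I.IsTwoSided ∧ Module.Finite k (A ⧸ I.restrictScalars k) ∧
    ∀ a ∈ I, f a = 0}
  zero_mem' := ⟨⊤, inferInstance, by
    have : Subsingleton (A ⧸ (⊤ : Ideal A).restrictScalars k) :=
      Submodule.Quotient.subsingleton_iff.2 (by simp)
    infer_instance, by simp⟩
  add_mem' := by
    rintro f g ⟨I, hI, hIf, hf⟩ ⟨J, hJ, hJf, hg⟩
    refine ⟨I ⊓ J, ⟨fun b ha => ⟨hI.mul_mem_of_left b ha.1, hJ.mul_mem_of_left b ha.2⟩⟩, ?_,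
      fun a ha => by simp [hf a ha.1, hg a ha.2]⟩
    let φ : A →ₗ[k] (A ⧸ I.restrictScalars k) × (A ⧸ J.restrictScalars k) :=
      (Submodule.mkQ _).prod (Submodule.mkQ _)
    have hφ : LinearMap.ker φ = (I ⊓ J).restrictScalars k := by
      ext x
      simp [φ, LinearMap.ker_prod]
    rw [← hφ]
    exact Module.Finite.equiv φ.quotKerEquivRange.symm
  smul_mem' := by
    rintro r f ⟨I, hI, hIf, hf⟩
    exact ⟨I, hI, hIf, fun a ha => by simp [hf a ha]⟩

/-- For a finite-dimensional algebra the finite dual is the whole dual space. -/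
theorem finiteDual_eq_top [Module.Finite k A] : finiteDual k A = ⊤ :=
  eq_top_iff.2 fun f _ => ⟨⊥, inferInstance, inferInstance, by simp⟩

namespace finiteDual

/-- The canonical map `A° ⊗ A° → (A ⊗ A)*`, `g ⊗ h ↦ (a ⊗ b ↦ g a * h b)`. -/
def pairing : finiteDual k A ⊗[k] finiteDual k A →ₗ[k] Module.Dual k (A ⊗[k] A) :=
  TensorProduct.dualDistrib k A A ∘ₗ
    TensorProduct.map (finiteDual k A).subtype (finiteDual k A).subtype

variable {k A} in
@[simp]
theorem pairing_tmul (g h : finiteDual k A) (a b : A) :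
    pairing k A (g ⊗ₜ h) (a ⊗ₜ b) = g.1 a * h.1 b := by
  simp [pairing]

instance : Module.Free k (finiteDual k A) := Module.Free.of_divisionRing k (finiteDual k A)

theorem pairing_injective : Function.Injective (pairing k A) := by
  rw [pairing, LinearMap.coe_comp]
  exact (CoalgTensor.dualDistrib_injective A A).comp
    (TensorProduct.map_injective_of_flat_flat _ _ (finiteDual k A).injective_subtype
      (finiteDual k A).injective_subtype)

variable {k A} in
theorem mul_mem_range_pairing (f : finiteDual k A) :
    f.1 ∘ₗ LinearMap.mul' k A ∈ LinearMap.range (pairing k A) := by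
  obtain ⟨f, I, hI, hfin, hf⟩ := f
  let Q := A ⧸ I.restrictScalars k
  let e := Module.Free.chooseBasis k Q
  let π : A →ₗ[k] Q := (I.restrictScalars k).mkQ
  have hπ : ∀ a ∈ I, π a = 0 := fun a ha => by
    have := (I.restrictScalars k).ker_mkQ
    exact LinearMap.mem_ker.1 (this.symm ▸ ha : a ∈ LinearMap.ker π)
  have hker : ∀ a, π a = 0 → a ∈ I := fun a ha => by
    have := (I.restrictScalars k).ker_mkQ
    exact (Submodule.restrictScalars_mem k I a).1 (this ▸ LinearMap.mem_ker.2 ha)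
  choose s hs using fun i => (I.restrictScalars k).mkQ_surjective (e i)
  let g : ∀ i, finiteDual k A := fun i => ⟨e.coord i ∘ₗ π, I, hI, hfin, fun a ha => by
    simp [hπ a ha]⟩
  let h : ∀ i, finiteDual k A := fun i => ⟨f ∘ₗ LinearMap.mulLeft k (s i), I, hI, hfin,
    fun a ha => hf _ (I.mul_mem_left _ ha)⟩
  refine ⟨∑ i, g i ⊗ₜ h i, ?_⟩
  ext a b
  simp only [map_sum, LinearMap.sum_apply, TensorProduct.AlgebraTensorModule.curry_apply,
    LinearMap.restrictScalars_self, TensorProduct.curry_apply, pairing_tmul]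
  simp only [g, h, LinearMap.comp_apply, LinearMap.mulLeft_apply, Module.Basis.coord_apply,
    LinearMap.mul'_apply]
  have h1 : a - ∑ i, e.repr (π a) i • s i ∈ I := by
    apply hker
    rw [map_sub, map_sum]
    simp only [map_smul, π, hs]
    rw [Module.Basis.sum_repr, sub_self]
  have h2 := hf _ (hI.mul_mem_of_left b h1)
  rw [sub_mul, map_sub, sub_eq_zero, Finset.sum_mul, map_sum] at h2
  rw [h2]
  simp

/-- The comultiplication of `A°`: the unique `Δ` with `Δ f = ∑ g ⊗ h` whenever
`f (a * b) = ∑ g a * h b` for all `a b`. -/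
def comulAux : finiteDual k A →ₗ[k] finiteDual k A ⊗[k] finiteDual k A :=
  (LinearEquiv.ofInjective _ (pairing_injective k A)).symm.toLinearMap ∘ₗ
    LinearMap.codRestrict _
      ((LinearMap.lcomp k k (LinearMap.mul' k A)) ∘ₗ (finiteDual k A).subtype)
      fun f => mul_mem_range_pairing f

variable {k A} in
theorem pairing_comulAux (f : finiteDual k A) :
    pairing k A (comulAux k A f) = f.1 ∘ₗ LinearMap.mul' k A := by
  have := LinearEquiv.apply_symm_apply (LinearEquiv.ofInjective _ (pairing_injective k A))
    (LinearMap.codRestrict _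
      ((LinearMap.lcomp k k (LinearMap.mul' k A)) ∘ₗ (finiteDual k A).subtype)
      (fun f => mul_mem_range_pairing f) f)
  exact congrArg Subtype.val this

/-- The counit of `A°` is evaluation at `1`. -/
instance instCoalgebraStruct : CoalgebraStruct k (finiteDual k A) where
  comul := comulAux k A
  counit := LinearMap.applyₗ (1 : A) ∘ₗ (finiteDual k A).subtype

/-- The canonical map `A° ⊗ (A° ⊗ A°) → (A ⊗ (A ⊗ A))*`. -/
def pairing₃ : finiteDual k A ⊗[k] (finiteDual k A ⊗[k] finiteDual k A) →ₗ[k]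
    Module.Dual k (A ⊗[k] (A ⊗[k] A)) :=
  TensorProduct.dualDistrib k A (A ⊗[k] A) ∘ₗ
    TensorProduct.map (finiteDual k A).subtype (pairing k A)

theorem pairing₃_injective : Function.Injective (pairing₃ k A) := by
  rw [pairing₃, LinearMap.coe_comp]
  exact (CoalgTensor.dualDistrib_injective A (A ⊗[k] A)).comp
    (TensorProduct.map_injective_of_flat_flat _ _ (finiteDual k A).injective_subtype
      (pairing_injective k A))

instance instCoalgebra : Coalgebra k (finiteDual k A) where
  coassoc := by
    change _ ∘ₗ LinearMap.rTensor _ (comulAux k A) ∘ₗ comulAux k A =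
      LinearMap.lTensor _ (comulAux k A) ∘ₗ comulAux k A
    refine LinearMap.ext fun f => pairing₃_injective k A ?_
    have h1 : ∀ (z : finiteDual k A ⊗[k] finiteDual k A) (a b d : A),
        pairing₃ k A (TensorProduct.assoc k _ _ _ (LinearMap.rTensor _ (comulAux k A) z))
          (a ⊗ₜ (b ⊗ₜ d)) = pairing k A z ((a * b) ⊗ₜ d) := by
      intro z a b d
      induction z using TensorProduct.induction_on with
      | zero => simp
      | tmul g h =>
        have e1 : ∀ t : finiteDual k A ⊗[k] finiteDual k A,
            pairing₃ k A (TensorProduct.assoc k _ _ _ (t ⊗ₜ h)) (a ⊗ₜ (b ⊗ₜ d)) =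
            pairing k A t (a ⊗ₜ b) * h.1 d := by
          intro t
          induction t using TensorProduct.induction_on with
          | zero => simp
          | tmul x y => simp [pairing₃, mul_assoc]
          | add x y hx hy =>
            simp only [TensorProduct.add_tmul, map_add, LinearMap.add_apply, hx, hy, add_mul]
        rw [LinearMap.rTensor_tmul, e1, pairing_comulAux]
        simp
      | add x y hx hy => simp only [map_add, LinearMap.add_apply, hx, hy]
    have h2 : ∀ (z : finiteDual k A ⊗[k] finiteDual k A) (a b d : A),
        pairing₃ k A (LinearMap.lTensor _ (comulAux k A) z)
          (a ⊗ₜ (b ⊗ₜ d)) = pairing k A z (a ⊗ₜ (b * d)) := by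
      intro z a b d
      induction z using TensorProduct.induction_on with
      | zero => simp
      | tmul g h => simp [pairing₃, pairing_comulAux]
      | add x y hx hy => simp only [map_add, LinearMap.add_apply, hx, hy]
    ext a b d
    simp only [TensorProduct.AlgebraTensorModule.curry_apply, LinearMap.restrictScalars_self,
      TensorProduct.curry_apply, LinearMap.comp_apply, LinearEquiv.coe_coe]
    rw [h1, h2, pairing_comulAux]
    simp [mul_assoc]
  rTensor_counit_comp_comul := by
    change LinearMap.rTensor _ (LinearMap.applyₗ (1 : A) ∘ₗ (finiteDual k A).subtype) ∘ₗ
      comulAux k A = _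
    refine LinearMap.ext fun f => (TensorProduct.lid k _).injective ?_
    have h : ∀ (z : finiteDual k A ⊗[k] finiteDual k A) (a : A),
        (TensorProduct.lid k _ (LinearMap.rTensor _
          (LinearMap.applyₗ (1 : A) ∘ₗ (finiteDual k A).subtype) z)).1 a =
        pairing k A z (1 ⊗ₜ a) := by
      intro z a
      induction z using TensorProduct.induction_on with
      | zero => simp
      | tmul g h => simp
      | add x y hx hy =>
        simp only [map_add, LinearMap.add_apply, ← hx, ← hy, Submodule.coe_add]
    ext a
    rw [LinearMap.comp_apply, h, pairing_comulAux]
    simp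
  lTensor_counit_comp_comul := by
    change LinearMap.lTensor _ (LinearMap.applyₗ (1 : A) ∘ₗ (finiteDual k A).subtype) ∘ₗ
      comulAux k A = _
    refine LinearMap.ext fun f => (TensorProduct.rid k _).injective ?_
    have h : ∀ (z : finiteDual k A ⊗[k] finiteDual k A) (a : A),
        (TensorProduct.rid k _ (LinearMap.lTensor _
          (LinearMap.applyₗ (1 : A) ∘ₗ (finiteDual k A).subtype) z)).1 a =
        pairing k A z (a ⊗ₜ 1) := by
      intro z a
      induction z using TensorProduct.induction_on with
      | zero => simp
      | tmul g h => simp [mul_comm]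
      | add x y hx hy =>
        simp only [map_add, LinearMap.add_apply, ← hx, ← hy, Submodule.coe_add]
    ext a
    rw [LinearMap.comp_apply, h, pairing_comulAux]
    simp

end finiteDual

end FiniteDual

end

/-! Write `leftAct f` and `rightAct f` for the two actions of a linear form on `C`. Right coideals
are the subspaces stable under every `rightAct f`. By coassociativity each `leftAct f` commutes with
these, so it is a comodule endomorphism, and images, preimages and kernels of right coideals are
right coideals. Finiteness comes from `finite_gen`: every element lies in a finite-dimensional right
coideal.

Embedding. If a chain coalgebra has a group-like element in every nonzero right coideal, there is
one group-like `g`, and it lies in all of them. A form `f` with `f g = 0` acts locally nilpotently,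
and `x ↦ ∑ ε((leftAct f)ⁿ x) cₙ` is a coalgebra map to the divided power coalgebra. Choosing `f`
nonzero on a minimal right coideal not inside `k ∙ g` makes the kernel of `leftAct f` at most `k ∙
g`, hence the map injective. Conversely, a right coideal of the divided power coalgebra is
determined by the initial segment of those `cₙ` that it contains. This yields the chain property,
pointedness, and the comparison with the finite duals, where the map is `f ↦ ∑ f(xⁿ) cₙ`.

Group-likes. A minimal right coideal `S` turns out to be stable under all `leftAct f`. In the
pointed case it is then a simple subcoalgebra, hence a line. Over an algebraically closed field an
eigenvalue argument shows that every form on `S` is a multiple of the counit, so `S` is again a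
line.

Distributivity. The main tool is `map_leftAct_inf_map_leftAct`: distributivity prevents `X/(X ∩ Y)`
and `Y/(X ∩ Y)` from having images under left actions that meet nontrivially. It gives the stability
of `S` above, and shows that the component of a group-like `g` (the sum of the right coideals whose
only group-like is `g`) is a subcoalgebra and a chain. The components are independent and span `C`,
and each embeds into the divided power coalgebra. -/

namespace RightCoideal

open TensorProduct

/-! ### The two actions of linear forms, and right coideals as stable subspaces -/

section Actions

variable {k : Type*} {C : Type*} [Field k] [AddCommGroup C] [Module k C] [Coalgebra k C]

/-- The action `x ↦ ∑ f(x₂) x₁` of a linear form on a coalgebra. -/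
noncomputable def rightAct (f : C →ₗ[k] k) : C →ₗ[k] C :=
  (TensorProduct.rid k C).toLinearMap ∘ₗ LinearMap.lTensor C f ∘ₗ Coalgebra.comul

/-- The action `x ↦ ∑ f(x₁) x₂` of a linear form on a coalgebra. -/
noncomputable def leftAct (f : C →ₗ[k] k) : C →ₗ[k] C :=
  (TensorProduct.lid k C).toLinearMap ∘ₗ LinearMap.rTensor C f ∘ₗ Coalgebra.comul

theorem rightAct_apply (f : C →ₗ[k] k) (x : C) :
    rightAct f x = TensorProduct.rid k C (LinearMap.lTensor C f (Coalgebra.comul x)) := rfl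

theorem leftAct_apply (f : C →ₗ[k] k) (x : C) :
    leftAct f x = TensorProduct.lid k C (LinearMap.rTensor C f (Coalgebra.comul x)) := rfl

@[simp]
theorem rightAct_counit (x : C) : rightAct (Coalgebra.counit (R := k)) x = x := by
  simp [rightAct_apply]

@[simp]
theorem leftAct_counit (x : C) : leftAct (Coalgebra.counit (R := k)) x = x := by
  simp [leftAct_apply]

theorem leftAct_sub (f g : C →ₗ[k] k) (x : C) :
    leftAct (f - g) x = leftAct f x - leftAct g x := by
  simp [leftAct_apply, LinearMap.rTensor_sub]

theorem leftAct_smul (a : k) (f : C →ₗ[k] k) (x : C) :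
    leftAct (a • f) x = a • leftAct f x := by
  simp [leftAct_apply, LinearMap.rTensor_smul]

/-- Both sides are `(f ⊗ l)(Δ x)`. As linear forms separate points, this identity turns questions
about one action into questions about the other. -/
theorem apply_leftAct (f l : C →ₗ[k] k) (x : C) : l (leftAct f x) = f (rightAct l x) := by
  rw [leftAct_apply, rightAct_apply]
  generalize (Coalgebra.comul x : C ⊗[k] C) = z
  induction z using TensorProduct.induction_on with
  | zero => simp
  | tmul a b => simp [mul_comm]
  | add a b ha hb => simp only [map_add, ha, hb]

@[simp]
theorem counit_leftAct (f : C →ₗ[k] k) (x : C) : Coalgebra.counit (R := k) (leftAct f x) = f x := by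
  rw [apply_leftAct, rightAct_counit]

@[simp]
theorem counit_rightAct (f : C →ₗ[k] k) (x : C) :
    Coalgebra.counit (R := k) (rightAct f x) = f x := by
  rw [← apply_leftAct, leftAct_counit]

/-- This is coassociativity: either order contracts the outer two legs of the iterated coproduct, by
`h` on the left and `f` on the right. -/
theorem rightAct_leftAct (f h : C →ₗ[k] k) (x : C) :
    rightAct f (leftAct h x) = leftAct h (rightAct f x) := by
  have key := Coalgebra.coassoc_apply (R := k) x
  have h1 : ∀ z : C ⊗[k] C, rightAct f (TensorProduct.lid k C (LinearMap.rTensor C h z)) =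
      TensorProduct.lid k C (TensorProduct.map h
        ((TensorProduct.rid k C).toLinearMap ∘ₗ LinearMap.lTensor C f)
        (LinearMap.lTensor C Coalgebra.comul z)) := by
    intro z
    induction z using TensorProduct.induction_on with
    | zero => simp
    | tmul a b =>
      simp only [LinearMap.rTensor_tmul, TensorProduct.lid_tmul, map_smul, rightAct_apply,
        LinearMap.lTensor_tmul, TensorProduct.map_tmul, LinearMap.comp_apply,
        LinearEquiv.coe_coe]
    | add a b ha hb => simp only [map_add, ha, hb]
  have h2 : ∀ z : C ⊗[k] C, leftAct h (TensorProduct.rid k C (LinearMap.lTensor C f z)) =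
      TensorProduct.lid k C (TensorProduct.map h
        ((TensorProduct.rid k C).toLinearMap ∘ₗ LinearMap.lTensor C f)
        (TensorProduct.assoc k C C C (LinearMap.rTensor C Coalgebra.comul z))) := by
    intro z
    induction z using TensorProduct.induction_on with
    | zero => simp
    | tmul a b =>
      simp only [LinearMap.lTensor_tmul, TensorProduct.rid_tmul, map_smul, leftAct_apply,
        LinearMap.rTensor_tmul]
      generalize (Coalgebra.comul a : C ⊗[k] C) = t
      induction t using TensorProduct.induction_on with
      | zero => simp
      | tmul c d =>
        simp only [LinearMap.rTensor_tmul, TensorProduct.lid_tmul, TensorProduct.assoc_tmul,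
          TensorProduct.map_tmul, LinearMap.comp_apply, LinearMap.lTensor_tmul,
          LinearEquiv.coe_coe, TensorProduct.rid_tmul]
        exact smul_comm _ _ _
      | add c d hc hd => simp only [map_add, smul_add, TensorProduct.add_tmul, hc, hd]
    | add a b ha hb => simp only [map_add, ha, hb]
  rw [leftAct_apply, h1, rightAct_apply, h2, key]

theorem eq_of_forall_dual {V : Type*} [AddCommGroup V] [Module k V] {x y : V}
    (h : ∀ l : V →ₗ[k] k, l x = l y) : x = y := by
  rw [← sub_eq_zero]
  exact (Module.forall_dual_apply_eq_zero_iff k _).1 fun l => by simp [h l]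

theorem rightAct_rightAct (f g : C →ₗ[k] k) (x : C) :
    rightAct g (rightAct f x) = rightAct (f ∘ₗ leftAct g) x := by
  refine eq_of_forall_dual (k := k) fun l => ?_
  rw [← apply_leftAct, ← apply_leftAct l (f ∘ₗ leftAct g) x, ← rightAct_leftAct,
    ← apply_leftAct, LinearMap.comp_apply]

omit [Coalgebra k C] in
theorem eq_of_forall_lTensor {M : Type*} [AddCommGroup M] [Module k M] {z w : M ⊗[k] C}
    (h : ∀ f : C →ₗ[k] k, TensorProduct.rid k M (LinearMap.lTensor M f z) =
      TensorProduct.rid k M (LinearMap.lTensor M f w)) : z = w := by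
  rw [← sub_eq_zero]
  have : z - w ∈ LinearMap.range (LinearMap.rTensor C (⊥ : Submodule k M).subtype) := by
    rw [CoalgTensor.mem_range_rTensor_iff]
    intro f
    simp only [map_sub, h f, sub_self, Submodule.mem_bot]
  obtain ⟨t, ht⟩ := this
  rw [← ht]
  have : (⊥ : Submodule k M).subtype = 0 := by
    ext x
    exact (Submodule.mem_bot k).1 x.2
  simp [this]

theorem isRightCoideal_iff {N : Submodule k C} :
    IsRightCoideal k C N ↔ ∀ f : C →ₗ[k] k, ∀ x ∈ N, rightAct f x ∈ N := by
  simp only [IsRightCoideal, CoalgTensor.mem_range_rTensor_iff]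
  exact ⟨fun h f x hx => h x hx f, fun h x hx f => h f x hx⟩

theorem isRightCoideal_bot : IsRightCoideal k C ⊥ := by
  simp [isRightCoideal_iff]

theorem isRightCoideal_top : IsRightCoideal k C ⊤ := by
  simp [isRightCoideal_iff]

theorem isRightCoideal_sSup {𝒩 : Set (Submodule k C)} (h : ∀ N ∈ 𝒩, IsRightCoideal k C N) :
    IsRightCoideal k C (sSup 𝒩) := by
  rw [isRightCoideal_iff]
  intro f
  change sSup 𝒩 ≤ (sSup 𝒩).comap (rightAct f)
  exact sSup_le fun N hN x hx => (le_sSup hN : N ≤ sSup 𝒩) (isRightCoideal_iff.1 (h N hN) f x hx)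

theorem isRightCoideal_inf {N L : Submodule k C} (hN : IsRightCoideal k C N)
    (hL : IsRightCoideal k C L) : IsRightCoideal k C (N ⊓ L) :=
  (rightCoideals k C).infClosed hN hL

theorem isRightCoideal_map {N : Submodule k C} (hN : IsRightCoideal k C N) (h : C →ₗ[k] k) :
    IsRightCoideal k C (N.map (leftAct h)) := by
  rw [isRightCoideal_iff]
  rintro f _ ⟨x, hx, rfl⟩
  rw [rightAct_leftAct]
  exact ⟨_, isRightCoideal_iff.1 hN f x hx, rfl⟩

theorem isRightCoideal_comap {N : Submodule k C} (hN : IsRightCoideal k C N) (h : C →ₗ[k] k) :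
    IsRightCoideal k C (N.comap (leftAct h)) := by
  rw [isRightCoideal_iff]
  intro f x hx
  rw [Submodule.mem_comap, ← rightAct_leftAct]
  exact isRightCoideal_iff.1 hN f _ hx

theorem isRightCoideal_ker (h : C →ₗ[k] k) : IsRightCoideal k C (LinearMap.ker (leftAct h)) :=
  isRightCoideal_comap isRightCoideal_bot h

/-- Any form `l` takes `leftAct f x` to `f (rightAct l x)`, and `rightAct l x` stays in `N`. So on a
right coideal the left action depends only on the restriction of the form. -/
theorem leftAct_eq_zero {N : Submodule k C} (hN : IsRightCoideal k C N) {f : C →ₗ[k] k}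
    (hf : ∀ x ∈ N, f x = 0) {x : C} (hx : x ∈ N) : leftAct f x = 0 :=
  eq_of_forall_dual (k := k) fun l => by
    rw [apply_leftAct, hf _ (isRightCoideal_iff.1 hN l x hx), map_zero]

variable (k) in
/-- The right coideal generated by an element. -/
noncomputable def gen (x : C) : Submodule k C where
  carrier := {y | ∃ f : C →ₗ[k] k, rightAct f x = y}
  zero_mem' := ⟨0, by simp [rightAct_apply]⟩
  add_mem' := by
    rintro _ _ ⟨f, rfl⟩ ⟨g, rfl⟩
    exact ⟨f + g, by simp [rightAct_apply, LinearMap.lTensor_add]⟩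
  smul_mem' := by
    rintro a _ ⟨f, rfl⟩
    exact ⟨a • f, by simp [rightAct_apply, LinearMap.lTensor_smul]⟩

theorem mem_gen_self (x : C) : x ∈ gen k x := ⟨Coalgebra.counit, by simp⟩

theorem isRightCoideal_gen (x : C) : IsRightCoideal k C (gen k x) := by
  rw [isRightCoideal_iff]
  rintro f _ ⟨g, rfl⟩
  exact ⟨_, (rightAct_rightAct g f x).symm⟩

theorem gen_le {N : Submodule k C} (hN : IsRightCoideal k C N) {x : C} (hx : x ∈ N) :
    gen k x ≤ N := by
  rintro _ ⟨f, rfl⟩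
  exact isRightCoideal_iff.1 hN f x hx

/-- Local finiteness: write `Δ x` as a finite sum of pure tensors; every `rightAct f x` is a
combination of their left legs. -/
instance finite_gen (x : C) : Module.Finite k (gen k x) := by
  obtain ⟨s, hs⟩ := TensorProduct.exists_finset (R := k) (Coalgebra.comul (R := k) x)
  classical
  have : gen k x ≤ Submodule.span k (s.image Prod.fst : Set C) := by
    rintro _ ⟨f, rfl⟩
    rw [rightAct_apply, hs]
    simp only [map_sum, LinearMap.lTensor_tmul, TensorProduct.rid_tmul]
    refine Submodule.sum_mem _ fun i hi => Submodule.smul_mem _ _ (Submodule.subset_span ?_)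
    exact_mod_cast Finset.mem_image_of_mem _ hi
  exact Submodule.finiteDimensional_of_le this

/-! ### Group-like elements -/

theorem rightAct_of_isGroupLikeElem {g : C} (hg : IsGroupLikeElem k g) (f : C →ₗ[k] k) :
    rightAct f g = f g • g := by
  simp [rightAct_apply, hg.comul_eq_tmul_self]

theorem leftAct_of_isGroupLikeElem {g : C} (hg : IsGroupLikeElem k g) (f : C →ₗ[k] k) :
    leftAct f g = f g • g := by
  simp [leftAct_apply, hg.comul_eq_tmul_self]

theorem isRightCoideal_span {g : C} (hg : IsGroupLikeElem k g) :
    IsRightCoideal k C (k ∙ g) := by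
  rw [isRightCoideal_iff]
  intro f x hx
  obtain ⟨a, rfl⟩ := Submodule.mem_span_singleton.1 hx
  rw [map_smul, rightAct_of_isGroupLikeElem hg]
  exact Submodule.smul_mem _ _ (Submodule.smul_mem _ _ (Submodule.mem_span_singleton_self g))

/-- Each slice of `Δ g` is a multiple of `g`. Applying the counit identifies the scalar as `f g`,
which is the corresponding slice of `g ⊗ g`. -/
theorem isGroupLikeElem_of_isRightCoideal_span {g : C} (hg : IsRightCoideal k C (k ∙ g))
    (h1 : Coalgebra.counit (R := k) g = 1) : IsGroupLikeElem k g where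
  counit_eq_one := h1
  comul_eq_tmul_self := by
    refine eq_of_forall_lTensor fun f => ?_
    obtain ⟨a, ha⟩ := Submodule.mem_span_singleton.1
      (isRightCoideal_iff.1 hg f g (Submodule.mem_span_singleton_self g))
    have h2 := congrArg (Coalgebra.counit (R := k)) ha
    rw [counit_rightAct, map_smul, h1, smul_eq_mul, mul_one] at h2
    rw [← rightAct_apply, ← ha, h2]
    simp

theorem eq_of_mem_span_of_isGroupLikeElem {g h : C} (hg : IsGroupLikeElem k g)
    (hh : IsGroupLikeElem k h) (hm : h ∈ k ∙ g) : h = g := by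
  obtain ⟨a, rfl⟩ := Submodule.mem_span_singleton.1 hm
  have := hh.counit_eq_one
  rw [map_smul, hg.counit_eq_one, smul_eq_mul, mul_one] at this
  rw [this, one_smul]

omit [Coalgebra k C] in
theorem mem_of_inf_span_ne_bot {N : Submodule k C} {g : C} (h : N ⊓ (k ∙ g) ≠ ⊥) : g ∈ N := by
  obtain ⟨x, ⟨hx, hxg⟩, hx0⟩ := Submodule.exists_mem_ne_zero_of_ne_bot h
  obtain ⟨a, rfl⟩ := Submodule.mem_span_singleton.1 hxg
  have ha : a ≠ 0 := by
    rintro rfl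
    simp at hx0
  exact (N.smul_mem_iff ha).1 hx

/-- Every nonzero right coideal contains a minimal one, which is finite-dimensional. -/
theorem exists_minimal {N : Submodule k C} (hN : IsRightCoideal k C N) (h0 : N ≠ ⊥) :
    ∃ S ≤ N, IsRightCoideal k C S ∧ S ≠ ⊥ ∧ Module.Finite k S ∧
      ∀ T ≤ S, IsRightCoideal k C T → T ≠ ⊥ → T = S := by
  obtain ⟨x, hx, hx0⟩ := Submodule.exists_mem_ne_zero_of_ne_bot h0
  have hex : ∃ n, ∃ S ≤ N, IsRightCoideal k C S ∧ S ≠ ⊥ ∧ Module.Finite k S ∧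
      Module.finrank k S = n := by
    refine ⟨_, gen k x, gen_le hN hx, isRightCoideal_gen x, ?_, inferInstance, rfl⟩
    intro h
    have := mem_gen_self (k := k) x
    rw [h] at this
    exact hx0 (by simpa using this)
  classical
  obtain ⟨S, hSN, hS, hS0, hSf, hSr⟩ := Nat.find_spec hex
  refine ⟨S, hSN, hS, hS0, hSf, fun T hTS hT hT0 => ?_⟩
  have hTf : Module.Finite k T := Submodule.finiteDimensional_of_le hTS
  refine Submodule.eq_of_le_of_finrank_le hTS ?_
  rw [hSr]
  exact Nat.find_min' hex ⟨T, hTS.trans hSN, hT, hT0, hTf, rfl⟩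

end Actions

/-! ### Subcoalgebras from two-sided stability, and one-dimensional right coideals -/

section Subcoalgebras

variable {k : Type*} {C : Type*} [Field k] [AddCommGroup C] [Module k C]

theorem eq_of_forall_rTensor {M : Type*} [AddCommGroup M] [Module k M] {z w : C ⊗[k] M}
    (h : ∀ f : C →ₗ[k] k, TensorProduct.lid k M (LinearMap.rTensor M f z) =
      TensorProduct.lid k M (LinearMap.rTensor M f w)) : z = w := by
  refine (TensorProduct.comm k C M).injective (eq_of_forall_lTensor fun f => ?_)
  have : ∀ z : C ⊗[k] M, TensorProduct.rid k M
      (LinearMap.lTensor M f (TensorProduct.comm k C M z)) =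
      TensorProduct.lid k M (LinearMap.rTensor M f z) := by
    intro z
    induction z using TensorProduct.induction_on with
    | zero => simp
    | tmul a b => simp
    | add a b ha hb => simp only [map_add, ha, hb]
  rw [this, this, h]

variable [Coalgebra k C]

/-- A subspace stable under both actions of the linear forms is a subcoalgebra. -/
def subcoalgebraOfStable (N : Submodule k C) (hN : IsRightCoideal k C N)
    (hU : ∀ f : C →ₗ[k] k, ∀ x ∈ N, leftAct f x ∈ N) : Subcoalgebra k C where
  toSubmodule := N
  comul_mem' := by
    intro x hx
    -- A linear retraction `π` onto `N`. Stability under the two actions says that `Δ x` is fixed by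
    -- `id ⊗ π` and by `π ⊗ id`, so `Δ x = (π ⊗ π)(Δ x)` comes from `N ⊗ N`.
    obtain ⟨π, hπ⟩ := N.subtype.exists_leftInverse_of_injective N.ker_subtype
    have hπ' : ∀ y ∈ N, (π y : C) = y := fun y hy =>
      congrArg Subtype.val (LinearMap.congr_fun hπ ⟨y, hy⟩)
    have h1 : LinearMap.lTensor C (N.subtype ∘ₗ π) (Coalgebra.comul x : C ⊗[k] C) =
        Coalgebra.comul x := by
      refine eq_of_forall_rTensor fun f => ?_
      have : ∀ z : C ⊗[k] C, TensorProduct.lid k C (LinearMap.rTensor C f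
          (LinearMap.lTensor C (N.subtype ∘ₗ π) z)) =
          π (TensorProduct.lid k C (LinearMap.rTensor C f z)) := by
        intro z
        induction z using TensorProduct.induction_on with
        | zero => simp
        | tmul a b => simp
        | add a b ha hb => simp only [map_add, ha, hb, Submodule.coe_add]
      rw [this, ← leftAct_apply]
      exact hπ' _ (hU f x hx)
    have h2 : LinearMap.rTensor C (N.subtype ∘ₗ π) (Coalgebra.comul x : C ⊗[k] C) =
        Coalgebra.comul x := by
      refine eq_of_forall_lTensor fun f => ?_
      have : ∀ z : C ⊗[k] C, TensorProduct.rid k C (LinearMap.lTensor C f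
          (LinearMap.rTensor C (N.subtype ∘ₗ π) z)) =
          π (TensorProduct.rid k C (LinearMap.lTensor C f z)) := by
        intro z
        induction z using TensorProduct.induction_on with
        | zero => simp
        | tmul a b => simp
        | add a b ha hb => simp only [map_add, ha, hb, Submodule.coe_add]
      rw [this, ← rightAct_apply]
      exact hπ' _ (isRightCoideal_iff.1 hN f x hx)
    refine ⟨TensorProduct.map π π (Coalgebra.comul x), ?_⟩
    rw [← LinearMap.comp_apply, ← TensorProduct.map_comp,
      ← LinearMap.lTensor_comp_rTensor, LinearMap.comp_apply, h2, h1]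

theorem isRightCoideal_subcoalgebra (D : Subcoalgebra k C) :
    IsRightCoideal k C D.toSubmodule := by
  intro x hx
  obtain ⟨t, ht⟩ := D.comul_mem' x hx
  refine ⟨LinearMap.lTensor _ D.toSubmodule.subtype t, ?_⟩
  rw [← ht, ← LinearMap.comp_apply, LinearMap.rTensor_comp_lTensor]

/-- If `ε s = 0`, then every `f s = ε (rightAct f s)` is a multiple of `ε s`, so `s = 0`. Hence `s`
can be rescaled to counit `1`. -/
theorem exists_isGroupLikeElem_of_span {s : C} (hs : IsRightCoideal k C (k ∙ s)) (h0 : s ≠ 0) :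
    ∃ g ∈ k ∙ s, IsGroupLikeElem k g := by
  have hε : Coalgebra.counit (R := k) s ≠ 0 := by
    intro hε
    refine h0 ((Module.forall_dual_apply_eq_zero_iff k s).1 fun f => ?_)
    obtain ⟨a, ha⟩ := Submodule.mem_span_singleton.1
      (isRightCoideal_iff.1 hs f s (Submodule.mem_span_singleton_self s))
    rw [← counit_rightAct, ← ha, map_smul, hε, smul_zero]
  refine ⟨(Coalgebra.counit (R := k) s)⁻¹ • s,
    Submodule.smul_mem _ _ (Submodule.mem_span_singleton_self s),
    isGroupLikeElem_of_isRightCoideal_span ?_ ?_⟩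
  · rwa [Submodule.span_singleton_smul_eq (IsUnit.mk0 _ (inv_ne_zero hε))]
  · rw [map_smul, smul_eq_mul, inv_mul_cancel₀ hε]

end Subcoalgebras

/-! ### Chain coalgebras and powers of the left action -/

section Chain

variable {k : Type*} {C : Type*} [Field k] [AddCommGroup C] [Module k C] [Coalgebra k C]

theorem le_or_le_of_isChainCoalgebra (hC : IsChainCoalgebra k C) {N L : Submodule k C}
    (hN : IsRightCoideal k C N) (hL : IsRightCoideal k C L) : N ≤ L ∨ L ≤ N :=
  hC.le_or_le ⟨N, hN⟩ ⟨L, hL⟩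

/-- In a pointed chain coalgebra every nonzero right coideal contains a group-like element. -/
theorem exists_isGroupLikeElem_of_pointed (hC : IsChainCoalgebra k C)
    (hp : IsPointedCoalgebra k C) {N : Submodule k C} (hN : IsRightCoideal k C N) (h0 : N ≠ ⊥) :
    ∃ g ∈ N, IsGroupLikeElem k g := by
  obtain ⟨S, hSN, hS, hS0, hSf, hmin⟩ := exists_minimal hN h0
  have hU : ∀ f : C →ₗ[k] k, S.map (leftAct f) ≤ S := by
    intro f
    -- The image is comparable with `S` and has no larger dimension, so it lies in `S` in either
    -- case.
    rcases le_or_le_of_isChainCoalgebra hC (isRightCoideal_map hS f) hS with h | h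
    · exact h
    · exact (Submodule.eq_of_le_of_finrank_le h (Submodule.finrank_map_le _ _)).ge
  let D := subcoalgebraOfStable S hS fun f x hx => hU f ⟨x, hx, rfl⟩
  have hD : D.IsSimple := by
    refine ⟨hS0, fun E hE => ?_⟩
    by_cases hE0 : E.toSubmodule = ⊥
    · exact Or.inl hE0
    · exact Or.inr (hmin _ hE (isRightCoideal_subcoalgebra E) hE0)
  have h1 : Module.finrank k S = 1 := hp D hD
  obtain ⟨s, hs0, hs⟩ := finrank_eq_one_iff'.1 h1
  have hSs : S = k ∙ (s : C) := by
    refine le_antisymm (fun t ht => ?_) ?_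
    · obtain ⟨a, ha⟩ := hs ⟨t, ht⟩
      exact Submodule.mem_span_singleton.2 ⟨a, congrArg Subtype.val ha⟩
    · rw [Submodule.span_singleton_le_iff_mem]
      exact s.2
  obtain ⟨g, hgS, hg⟩ := exists_isGroupLikeElem_of_span (hSs ▸ hS)
    (fun h => hs0 (Subtype.ext h))
  exact ⟨g, hSN (hSs ▸ hgS), hg⟩

theorem isDistributiveCoalgebra_of_isChainCoalgebra (hC : IsChainCoalgebra k C) :
    IsDistributiveCoalgebra k C := by
  intro N L M
  rcases hC.le_or_le L M with h | h
  · rw [sup_eq_right.2 h, sup_eq_right.2 (inf_le_inf_left N h)]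
  · rw [sup_eq_left.2 h, sup_eq_left.2 (inf_le_inf_left N h)]

theorem rightAct_leftAct_pow (f h : C →ₗ[k] k) (n : ℕ) (x : C) :
    rightAct f ((leftAct h ^ n) x) = (leftAct h ^ n) (rightAct f x) := by
  induction n generalizing x with
  | zero => simp
  | succ n ih => rw [pow_succ, Module.End.mul_apply, Module.End.mul_apply, ih, rightAct_leftAct]

/-- The form `ε ∘ (leftAct f)ⁿ` is the `n`-th convolution power of `f`, and acting by it is
iterating the action of `f`. -/
theorem leftAct_counit_comp_pow (f : C →ₗ[k] k) (n : ℕ) :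
    leftAct (Coalgebra.counit ∘ₗ (leftAct f ^ n)) = leftAct f ^ n := by
  ext x
  refine eq_of_forall_dual (k := k) fun l => ?_
  rw [apply_leftAct, LinearMap.comp_apply, ← rightAct_leftAct_pow, counit_rightAct]

end Chain

/-! ### Coalgebra maps to the divided power coalgebra -/

section ToDividedPower

variable {k : Type u} {C : Type*} [Field k] [AddCommGroup C] [Module k C] [Coalgebra k C]

/-- Dual form of `xⁱ xʲ = xⁱ⁺ʲ`; it allows identities of comultiplications to be checked
coefficientwise. -/
theorem tensorProduct_repr_comul (y : DividedPower k) (i j : ℕ) :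
    ((DividedPower.c k).tensorProduct (DividedPower.c k)).repr (Coalgebra.comul y) (i, j) =
      (DividedPower.c k).repr y (i + j) := by
  let b := (DividedPower.c k).tensorProduct (DividedPower.c k)
  suffices h : b.coord (i, j) ∘ₗ Coalgebra.comul = (DividedPower.c k).coord (i + j) from
    LinearMap.congr_fun h y
  refine (DividedPower.c k).ext fun n => ?_
  simp only [LinearMap.comp_apply, DividedPower.comul_c, map_sum, Module.Basis.coord_apply, b,
    Module.Basis.tensorProduct_repr_tmul_apply, Module.Basis.repr_self, smul_eq_mul]
  rw [Finsupp.single_apply]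
  split_ifs with h
  · rw [Finset.sum_eq_single (i, j)]
    · simp
    · rintro ⟨a, b⟩ - hne
      by_cases ha : a = i
      · have hb : b ≠ j := fun hb => hne (by rw [ha, hb])
        simp [Finsupp.single_apply, hb]
      · simp [Finsupp.single_apply, ha]
    · intro hn
      exact absurd (Finset.HasAntidiagonal.mem_antidiagonal.2 h.symm) hn
  · refine Finset.sum_eq_zero ?_
    rintro ⟨a, b⟩ hab
    rw [Finset.HasAntidiagonal.mem_antidiagonal] at hab
    by_cases ha : a = i
    · have hb : b ≠ j := by
        rintro rfl
        exact h (by rw [← hab, ← ha])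
      simp [Finsupp.single_apply, hb]
    · simp [Finsupp.single_apply, ha]

theorem finite_support_counit_leftAct_pow {f : C →ₗ[k] k} {x : C}
    (hf : ∃ n, (leftAct f ^ n) x = 0) :
    (Function.support fun n => Coalgebra.counit (R := k) ((leftAct f ^ n) x)).Finite := by
  obtain ⟨m, hm⟩ := hf
  refine (Set.finite_Iio m).subset fun n hn => ?_
  by_contra hnm
  rw [Set.mem_Iio, not_lt] at hnm
  exact hn (by simp [Module.End.pow_map_zero_of_le hnm hm])

/-- The linear map `x ↦ ∑ₙ fⁿ(x) cₙ` for a linear form `f` acting locally nilpotently. -/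
noncomputable def toDividedPowerLinear (f : C →ₗ[k] k) (hf : ∀ x, ∃ n, (leftAct f ^ n) x = 0) :
    C →ₗ[k] DividedPower k where
  toFun x := (DividedPower.c k).repr.symm
    (Finsupp.ofSupportFinite _ (finite_support_counit_leftAct_pow (hf x)))
  map_add' x y := by
    refine (DividedPower.c k).repr.injective ?_
    ext n
    simp [Finsupp.ofSupportFinite_coe]
  map_smul' a x := by
    refine (DividedPower.c k).repr.injective ?_
    ext n
    simp [Finsupp.ofSupportFinite_coe]

theorem repr_toDividedPowerLinear {f : C →ₗ[k] k} (hf : ∀ x, ∃ n, (leftAct f ^ n) x = 0) (x : C)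
    (n : ℕ) : (DividedPower.c k).repr (toDividedPowerLinear f hf x) n =
      Coalgebra.counit (R := k) ((leftAct f ^ n) x) := by
  simp [toDividedPowerLinear, Finsupp.ofSupportFinite_coe]

theorem counit_dividedPower (y : DividedPower k) :
    Coalgebra.counit (R := k) y = (DividedPower.c k).repr y 0 := by
  suffices h : Coalgebra.counit = (DividedPower.c k).coord 0 from LinearMap.congr_fun h y
  refine (DividedPower.c k).ext fun n => ?_
  rw [DividedPower.counit_c]
  simp [Finsupp.single_apply]

/-- A linear form `f` acting locally nilpotently defines the coalgebra homomorphism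
`x ↦ ∑ₙ fⁿ(x) cₙ` to the divided power coalgebra. -/
noncomputable def toDividedPower (f : C →ₗ[k] k) (hf : ∀ x, ∃ n, (leftAct f ^ n) x = 0) :
    C →ₗc[k] DividedPower k where
  toLinearMap := toDividedPowerLinear f hf
  counit_comp := by
    ext x
    rw [LinearMap.comp_apply, counit_dividedPower, repr_toDividedPowerLinear]
    simp
  map_comp_comul := by
    ext x
    refine ((DividedPower.c k).tensorProduct (DividedPower.c k)).repr.injective ?_
    ext ⟨i, j⟩
    rw [LinearMap.comp_apply, LinearMap.comp_apply, tensorProduct_repr_comul,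
      repr_toDividedPowerLinear]
    have h : ∀ z : C ⊗[k] C,
        ((DividedPower.c k).tensorProduct (DividedPower.c k)).repr
          (TensorProduct.map (toDividedPowerLinear f hf) (toDividedPowerLinear f hf) z) (i, j) =
        Coalgebra.counit (R := k) ((leftAct f ^ j) (TensorProduct.lid k C
          (LinearMap.rTensor C (Coalgebra.counit ∘ₗ (leftAct f ^ i)) z))) := by
      intro z
      induction z using TensorProduct.induction_on with
      | zero => simp
      | tmul a b =>
        simp [Module.Basis.tensorProduct_repr_tmul_apply, repr_toDividedPowerLinear, mul_comm]
      | add a b ha hb => simp only [map_add, Finsupp.add_apply, ha, hb]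
    rw [h, ← leftAct_apply, leftAct_counit_comp_pow, ← Module.End.mul_apply, ← pow_add, add_comm]

theorem repr_toDividedPower {f : C →ₗ[k] k} (hf : ∀ x, ∃ n, (leftAct f ^ n) x = 0) (x : C)
    (n : ℕ) : (DividedPower.c k).repr (toDividedPower f hf x) n =
      Coalgebra.counit (R := k) ((leftAct f ^ n) x) :=
  repr_toDividedPowerLinear hf x n

/-- Descend from a vanishing power: if `(leftAct f)ⁿ⁺¹ x = 0`, then `(leftAct f)ⁿ x` is in the
kernel of `leftAct f` and has counit zero, so it vanishes too. -/
theorem toDividedPower_injective {f : C →ₗ[k] k} (hf : ∀ x, ∃ n, (leftAct f ^ n) x = 0)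
    (h : ∀ x, leftAct f x = 0 → Coalgebra.counit (R := k) x = 0 → x = 0) :
    Function.Injective (toDividedPower f hf) := by
  rw [injective_iff_map_eq_zero]
  intro x hx
  have hε : ∀ n, Coalgebra.counit (R := k) ((leftAct f ^ n) x) = 0 := by
    intro n
    rw [← repr_toDividedPower hf, hx]
    simp
  obtain ⟨n, hn⟩ := hf x
  induction n with
  | zero => simpa using hn
  | succ n ih =>
    refine ih (h _ ?_ (hε n))
    rw [← Module.End.mul_apply, ← pow_succ', hn]

/-- A chain coalgebra all of whose nonzero right coideals contain group-like elements embeds into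
the divided power coalgebra. -/
theorem exists_injective_toDividedPower (hC : IsChainCoalgebra k C)
    (hg : ∀ N : Submodule k C, IsRightCoideal k C N → N ≠ ⊥ → ∃ g ∈ N, IsGroupLikeElem k g) :
    ∃ φ : C →ₗc[k] DividedPower k, Function.Injective φ := by
  classical
  have := hC.nontrivial
  obtain ⟨g, -, hgl⟩ := hg ⊤ isRightCoideal_top top_ne_bot
  have hgN : ∀ N : Submodule k C, IsRightCoideal k C N → N ≠ ⊥ → g ∈ N := by
    intro N hN h0
    obtain ⟨h, hhN, hh⟩ := hg N hN h0
    rcases le_or_le_of_isChainCoalgebra hC hN (isRightCoideal_span hgl) with hle | hle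
    · rwa [← eq_of_mem_span_of_isGroupLikeElem hgl hh (hle hhN)]
    · exact hle (Submodule.mem_span_singleton_self g)
  have hnil : ∀ f : C →ₗ[k] k, f g = 0 → ∀ x, ∃ n, (leftAct f ^ n) x = 0 := by
    intro f hf x
    have hU : leftAct f g = 0 := by rw [leftAct_of_isGroupLikeElem hgl, hf, zero_smul]
    -- The dimension of a nonzero finite-dimensional right coideal drops under `leftAct f`, since it
    -- contains `g`, which is killed.
    have key : ∀ n, ∀ N : Submodule k C, IsRightCoideal k C N → Module.Finite k N →
        Module.finrank k N ≤ n → ∀ x ∈ N, (leftAct f ^ n) x = 0 := by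
      intro n
      induction n with
      | zero =>
        intro N _ hfin hr x hx
        rw [Submodule.finrank_eq_zero.1 (Nat.le_zero.1 hr)] at hx
        simpa using hx
      | succ n ih =>
        intro N hN hfin hr x hx
        by_cases h0 : N = ⊥
        · rw [h0, Submodule.mem_bot] at hx
          simp [hx]
        rw [pow_succ, Module.End.mul_apply]
        refine ih (N.map (leftAct f)) (isRightCoideal_map hN f) inferInstance ?_ _ ⟨x, hx, rfl⟩
        have hker : LinearMap.ker ((leftAct f).domRestrict N) ≠ ⊥ := by
          intro hbot
          have hmem : (⟨g, hgN N hN h0⟩ : N) ∈ LinearMap.ker ((leftAct f).domRestrict N) := hU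
          rw [hbot, Submodule.mem_bot] at hmem
          exact hgl.ne_zero (congrArg Subtype.val hmem)
        have h1 := LinearMap.finrank_range_add_finrank_ker ((leftAct f).domRestrict N)
        rw [LinearMap.range_domRestrict] at h1
        have h2 := Submodule.one_le_finrank_iff.2 hker
        omega
    exact ⟨_, key _ _ (isRightCoideal_gen x) inferInstance le_rfl _ (mem_gen_self x)⟩
  suffices ∃ f : C →ₗ[k] k, f g = 0 ∧ LinearMap.ker (leftAct f) ≤ k ∙ g by
    obtain ⟨f, hf, hker⟩ := this
    refine ⟨toDividedPower f (hnil f hf), toDividedPower_injective _ fun x hx hε => ?_⟩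
    obtain ⟨a, rfl⟩ := Submodule.mem_span_singleton.1 (hker hx)
    rw [map_smul, hgl.counit_eq_one, smul_eq_mul, mul_one] at hε
    rw [hε, zero_smul]
  by_cases htop : ∀ x : C, x ∈ k ∙ g
  · exact ⟨0, rfl, fun x _ => htop x⟩
  push Not at htop
  obtain ⟨x, hx⟩ := htop
  -- Let `V` have least dimension among the right coideals not inside `k ∙ g`, and let `f` vanish on
  -- `g` but not on `V`. If the kernel of `leftAct f` were not inside `k ∙ g`, minimality and
  -- comparability would put `V` in it, and then `f = ε ∘ leftAct f` would vanish on `V`.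
  have hex : ∃ n, ∃ V : Submodule k C, IsRightCoideal k C V ∧ ¬ V ≤ k ∙ g ∧ Module.Finite k V ∧
      Module.finrank k V = n :=
    ⟨_, gen k x, isRightCoideal_gen x, fun h => hx (h (mem_gen_self x)), inferInstance, rfl⟩
  obtain ⟨V, hV, hVg, hVf, hVr⟩ := Nat.find_spec hex
  obtain ⟨y, hyV, hy⟩ := Set.not_subset.1 hVg
  obtain ⟨f, hfy, hf⟩ := Submodule.exists_dual_map_eq_bot_of_notMem hy inferInstance
  have hfg : f g = 0 := by
    have : f g ∈ (k ∙ g).map f := ⟨g, Submodule.mem_span_singleton_self g, rfl⟩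
    rw [hf] at this
    exact (Submodule.mem_bot k).1 this
  refine ⟨f, hfg, ?_⟩
  by_contra hker
  have hVker : V ≤ LinearMap.ker (leftAct f) := by
    rcases le_or_le_of_isChainCoalgebra hC hV (isRightCoideal_ker f) with h | h
    · exact h
    · have hfin : Module.Finite k (LinearMap.ker (leftAct f)) :=
        Submodule.finiteDimensional_of_le h
      refine (Submodule.eq_of_le_of_finrank_le h ?_).ge
      rw [hVr]
      exact Nat.find_min' hex ⟨_, isRightCoideal_ker f, hker, hfin, rfl⟩
  refine hfy ?_
  rw [← counit_leftAct, LinearMap.mem_ker.1 (hVker hyV), map_zero]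

end ToDividedPower

/-! ### Transport of right coideals and group-likes along injective coalgebra maps -/

section CoalgHoms

variable {k : Type*} {C E : Type*} [Field k] [AddCommGroup C] [Module k C] [Coalgebra k C]
  [AddCommGroup E] [Module k E] [Coalgebra k E]

theorem rightAct_coalgHom (φ : C →ₗc[k] E) (f : E →ₗ[k] k) (x : C) :
    rightAct f (φ x) = φ (rightAct (f ∘ₗ φ.toLinearMap) x) := by
  rw [rightAct_apply, rightAct_apply, ← CoalgHomClass.map_comp_comul_apply]
  generalize (Coalgebra.comul x : C ⊗[k] C) = z
  induction z using TensorProduct.induction_on with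
  | zero => simp
  | tmul a b => simp
  | add a b ha hb => simp only [map_add, ha, hb]

theorem exists_comp_eq_of_injective {V W : Type*} [AddCommGroup V] [Module k V] [AddCommGroup W]
    [Module k W] {φ : V →ₗ[k] W} (hφ : Function.Injective φ) (h : V →ₗ[k] k) :
    ∃ f : W →ₗ[k] k, f ∘ₗ φ = h := by
  obtain ⟨π, hπ⟩ := φ.exists_leftInverse_of_injective (LinearMap.ker_eq_bot.2 hφ)
  exact ⟨h ∘ₗ π, by rw [LinearMap.comp_assoc, hπ, LinearMap.comp_id]⟩

/-- Over a field every form on `C` extends along `φ` to `E`, so the two families of right actions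
agree on the image. -/
theorem isRightCoideal_map_coalgHom {φ : C →ₗc[k] E} (hφ : Function.Injective φ)
    {N : Submodule k C} : IsRightCoideal k E (N.map φ.toLinearMap) ↔ IsRightCoideal k C N := by
  rw [isRightCoideal_iff, isRightCoideal_iff]
  constructor
  · intro h f x hx
    obtain ⟨f, rfl⟩ := exists_comp_eq_of_injective (φ := φ.toLinearMap) hφ f
    obtain ⟨y, hy, hyx⟩ := h f (φ x) ⟨x, hx, rfl⟩
    rw [rightAct_coalgHom] at hyx
    rwa [← hφ hyx]
  · rintro h f _ ⟨x, hx, rfl⟩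
    exact ⟨_, h _ x hx, (rightAct_coalgHom φ f x).symm⟩

theorem isRightCoideal_comap_coalgHom {φ : C →ₗc[k] E} (hφ : Function.Injective φ)
    {N : Submodule k E} (hN : IsRightCoideal k E N) :
    IsRightCoideal k C (N.comap φ.toLinearMap) := by
  rw [isRightCoideal_iff]
  intro f x hx
  obtain ⟨f, rfl⟩ := exists_comp_eq_of_injective (φ := φ.toLinearMap) hφ f
  have := isRightCoideal_iff.1 hN f _ hx
  exact (rightAct_coalgHom φ f x ▸ this : φ _ ∈ N)

theorem map_coalgHom_injective {φ : C →ₗc[k] E} (hφ : Function.Injective φ) :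
    Function.Injective (TensorProduct.map φ.toLinearMap φ.toLinearMap) :=
  TensorProduct.map_injective_of_flat_flat _ _ hφ hφ

theorem isGroupLikeElem_of_coalgHom {φ : C →ₗc[k] E} (hφ : Function.Injective φ) {g : C}
    (hg : IsGroupLikeElem k (φ g)) : IsGroupLikeElem k g where
  counit_eq_one := by rw [← CoalgHomClass.counit_comp_apply φ, hg.counit_eq_one]
  comul_eq_tmul_self := by
    refine map_coalgHom_injective hφ ?_
    rw [TensorProduct.map_tmul]
    exact (CoalgHomClass.map_comp_comul_apply φ g).trans hg.comul_eq_tmul_self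

/-- The inclusion of a subcoalgebra. -/
def inclusion (D : Subcoalgebra k C) : D.toSubmodule →ₗc[k] C where
  toLinearMap := D.toSubmodule.subtype
  counit_comp := rfl
  map_comp_comul := D.map_subtype_comp_comulAux

theorem inclusion_injective (D : Subcoalgebra k C) : Function.Injective (inclusion D) :=
  D.toSubmodule.injective_subtype

/-- The range of a coalgebra homomorphism is a subcoalgebra. -/
def rangeSubcoalgebra (φ : C →ₗc[k] E) : Subcoalgebra k E where
  toSubmodule := LinearMap.range φ.toLinearMap
  comul_mem' := by
    rintro _ ⟨x, rfl⟩
    refine ⟨TensorProduct.map φ.toLinearMap.rangeRestrict φ.toLinearMap.rangeRestrict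
      (Coalgebra.comul x), ?_⟩
    rw [← LinearMap.comp_apply, ← TensorProduct.map_comp, LinearMap.subtype_comp_codRestrict]
    exact CoalgHomClass.map_comp_comul_apply φ x

/-- An injective coalgebra homomorphism onto a subcoalgebra is an isomorphism. -/
theorem nonempty_equiv_of_range_eq {φ : C →ₗc[k] E} (hφ : Function.Injective φ)
    {D : Subcoalgebra k E} (hD : LinearMap.range φ.toLinearMap = D.toSubmodule) :
    Nonempty (C ≃ₗc[k] D.toSubmodule) := by
  let ψ : C →ₗ[k] D.toSubmodule := φ.toLinearMap.codRestrict D.toSubmodule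
    fun x => hD.le (LinearMap.mem_range_self φ.toLinearMap x)
  let ψ' : C →ₗc[k] D.toSubmodule :=
    { ψ with
      counit_comp := φ.counit_comp
      map_comp_comul := by
        ext x
        refine D.map_subtype_injective ?_
        rw [LinearMap.comp_apply, LinearMap.comp_apply, ← LinearMap.comp_apply,
          ← TensorProduct.map_comp]
        exact (CoalgHomClass.map_comp_comul_apply φ x).trans
          (D.map_subtype_comulAux (ψ x)).symm }
  refine ⟨CoalgEquiv.ofBijective (f := ψ') ⟨fun x y h => hφ (congrArg Subtype.val h), fun y => ?_⟩⟩
  obtain ⟨x, hx⟩ : (y : E) ∈ LinearMap.range φ.toLinearMap := hD.ge y.2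
  exact ⟨x, Subtype.ext hx⟩

theorem nonempty_equiv_of_range_eq_range {D : Type*} [AddCommGroup D] [Module k D]
    [Coalgebra k D] {φ : C →ₗc[k] E} {ψ : D →ₗc[k] E} (hφ : Function.Injective φ)
    (hψ : Function.Injective ψ)
    (h : LinearMap.range φ.toLinearMap = LinearMap.range ψ.toLinearMap) :
    Nonempty (C ≃ₗc[k] D) := by
  obtain ⟨e⟩ := nonempty_equiv_of_range_eq (D := rangeSubcoalgebra ψ) hφ h
  obtain ⟨e'⟩ := nonempty_equiv_of_range_eq (D := rangeSubcoalgebra ψ) hψ rfl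
  exact ⟨e.trans e'.symm⟩

/-- This reduces every clause about nonzero subcoalgebras to the existence of an injective coalgebra
map. -/
theorem exists_subcoalgebra_iff : (∃ S : Subcoalgebra k E, S.toSubmodule ≠ ⊥ ∧
      Nonempty (C ≃ₗc[k] S.toSubmodule)) ↔
    Nontrivial C ∧ ∃ φ : C →ₗc[k] E, Function.Injective φ := by
  constructor
  · rintro ⟨S, hS, ⟨e⟩⟩
    have : Nontrivial S.toSubmodule := Submodule.nontrivial_iff_ne_bot.2 hS
    exact ⟨e.toEquiv.nontrivial, (inclusion S).comp e.toCoalgHom,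
      (inclusion_injective S).comp e.toEquiv.injective⟩
  · rintro ⟨hn, φ, hφ⟩
    refine ⟨rangeSubcoalgebra φ, ?_, nonempty_equiv_of_range_eq hφ rfl⟩
    intro h
    obtain ⟨x, hx⟩ := exists_ne (0 : C)
    have : φ x ∈ (rangeSubcoalgebra φ).toSubmodule := ⟨x, rfl⟩
    rw [h, Submodule.mem_bot] at this
    exact hx (hφ (this.trans (map_zero φ).symm))

end CoalgHoms

/-! ### Distributive coalgebras: group-likes and their components -/

section Distributive

variable {k : Type*} {C : Type*} [Field k] [AddCommGroup C] [Module k C] [Coalgebra k C]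

theorem inf_sup_eq (hC : IsDistributiveCoalgebra k C) {N L M : Submodule k C}
    (hN : IsRightCoideal k C N) (hL : IsRightCoideal k C L) (hM : IsRightCoideal k C M) :
    N ⊓ (L ⊔ M) = (N ⊓ L) ⊔ (N ⊓ M) :=
  congrArg Subtype.val (hC ⟨N, hN⟩ ⟨L, hL⟩ ⟨M, hM⟩)

/-- The sums `x + y` with `leftAct f x = leftAct f' y` form a right coideal `D ≤ X ⊔ Y`, so
distributivity splits `D` into `D ⊓ X` and `D ⊓ Y`. Replacing `x` by the `X`-part changes it by an
element of `X ⊓ Y`, which `leftAct f` kills. That part is `a + b` with `leftAct f a = leftAct f' b`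
and `b ∈ X ⊓ Y`, so `leftAct f` kills it as well. -/
theorem map_leftAct_inf_map_leftAct (hC : IsDistributiveCoalgebra k C) {X Y : Submodule k C}
    (hX : IsRightCoideal k C X) (hY : IsRightCoideal k C Y) {f f' : C →ₗ[k] k}
    (hf : ∀ x ∈ X ⊓ Y, f x = 0) (hf' : ∀ x ∈ X ⊓ Y, f' x = 0) :
    X.map (leftAct f) ⊓ Y.map (leftAct f') = ⊥ := by
  have hXY := isRightCoideal_inf hX hY
  let D : Submodule k C := (X.prod Y ⊓ LinearMap.ker ((leftAct f).coprod (-leftAct f'))).map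
    (LinearMap.id.coprod LinearMap.id)
  have hDmem : ∀ d, d ∈ D ↔ ∃ x ∈ X, ∃ y ∈ Y, leftAct f x = leftAct f' y ∧ x + y = d := by
    intro d
    constructor
    · rintro ⟨⟨x, y⟩, ⟨⟨hx, hy⟩, h⟩, rfl⟩
      refine ⟨x, hx, y, hy, ?_, by simp⟩
      have := LinearMap.mem_ker.1 h
      simpa [add_neg_eq_zero] using this
    · rintro ⟨x, hx, y, hy, h, rfl⟩
      exact ⟨(x, y), ⟨⟨hx, hy⟩, by simp [h]⟩, by simp⟩
  have hD : IsRightCoideal k C D := by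
    rw [isRightCoideal_iff]
    intro l d hd
    obtain ⟨x, hx, y, hy, h, rfl⟩ := (hDmem d).1 hd
    refine (hDmem _).2 ⟨_, isRightCoideal_iff.1 hX l x hx, _, isRightCoideal_iff.1 hY l y hy, ?_,
      (map_add _ _ _).symm⟩
    rw [← rightAct_leftAct, h, rightAct_leftAct]
  rw [eq_bot_iff]
  rintro _ ⟨⟨x, hx, rfl⟩, y, hy, h⟩
  have hmem : x + y ∈ D ⊓ (X ⊔ Y) :=
    ⟨(hDmem _).2 ⟨x, hx, y, hy, h.symm, rfl⟩, Submodule.add_mem_sup hx hy⟩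
  rw [inf_sup_eq hC hD hX hY] at hmem
  obtain ⟨x', ⟨hx'D, hx'⟩, y', ⟨-, hy'⟩, hsum⟩ := Submodule.mem_sup.1 hmem
  obtain ⟨a, ha, b, hb, hab, rfl⟩ := (hDmem _).1 hx'D
  have hbX : b ∈ X ⊓ Y := ⟨(X.add_mem_iff_right ha).1 hx', hb⟩
  have hxX : x - (a + b) ∈ X ⊓ Y := by
    refine ⟨X.sub_mem hx hx', ?_⟩
    have : x - (a + b) = y' - y := by
      rw [sub_eq_sub_iff_add_eq_add, ← hsum, add_comm]
    rw [this]
    exact Y.sub_mem hy' hy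
  have h1 := leftAct_eq_zero hXY hf hxX
  have h2 := leftAct_eq_zero hXY hf' hbX
  have h3 := leftAct_eq_zero hXY hf hbX
  rw [map_sub, map_add, hab, h2, h3, add_zero, sub_zero] at h1
  exact (Submodule.mem_bot k).2 h1

theorem map_leftAct_counit (N : Submodule k C) :
    N.map (leftAct (Coalgebra.counit (R := k))) = N := by
  have : leftAct (Coalgebra.counit (R := k) (A := C)) = LinearMap.id := by
    ext x
    simp
  rw [this, Submodule.map_id]

/-- In a distributive coalgebra over an algebraically closed field, every nonzero right coideal
contains a group-like element. -/
theorem exists_isGroupLikeElem_of_isAlgClosed [IsAlgClosed k] (hC : IsDistributiveCoalgebra k C)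
    {N : Submodule k C} (hN : IsRightCoideal k C N) (h0 : N ≠ ⊥) :
    ∃ g ∈ N, IsGroupLikeElem k g := by
  obtain ⟨S, hSN, hS, hS0, hSf, hmin⟩ := exists_minimal hN h0
  have hU : ∀ f : C →ₗ[k] k, S.map (leftAct f) ≤ S := by
    intro f
    -- If `S` met its image trivially, `map_leftAct_inf_map_leftAct` with the forms `f` and `ε`
    -- would make the image disjoint from itself, hence zero. Otherwise minimality puts `S` inside
    -- the image, and dimensions force equality.
    by_cases hbot : S ⊓ S.map (leftAct f) = ⊥
    · have hz : ∀ (l : C →ₗ[k] k), ∀ x ∈ S ⊓ S.map (leftAct f), l x = 0 := by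
        intro l x hx
        rw [hbot, Submodule.mem_bot] at hx
        rw [hx, map_zero]
      have := map_leftAct_inf_map_leftAct hC hS (isRightCoideal_map hS f) (hz f)
        (hz Coalgebra.counit)
      rw [map_leftAct_counit, inf_idem] at this
      rw [this]
      exact bot_le
    · have hle := hmin _ inf_le_left (isRightCoideal_inf hS (isRightCoideal_map hS f)) hbot
      exact (Submodule.eq_of_le_of_finrank_le (inf_eq_left.1 hle)
        (Submodule.finrank_map_le _ _)).ge
  have hnt : Nontrivial S := Submodule.nontrivial_iff_ne_bot.2 hS0
  -- An eigenvector of `leftAct f` with eigenvalue `a` lies in the kernel of `leftAct (f - a • ε)`.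
  -- By minimality this kernel contains `S`; applying `ε` gives `f = a • ε` on `S`.
  have hscal : ∀ f : C →ₗ[k] k, ∃ a : k, ∀ x ∈ S, f x = a * Coalgebra.counit (R := k) x := by
    intro f
    let F : Module.End k S := (leftAct f).restrict fun x hx => hU f ⟨x, hx, rfl⟩
    obtain ⟨a, ha⟩ := Module.End.exists_eigenvalue F
    obtain ⟨s, hs⟩ := ha.exists_hasEigenvector
    refine ⟨a, ?_⟩
    have hs1 : leftAct f (s : C) = a • (s : C) := congrArg Subtype.val hs.apply_eq_smul
    have hle : S ⊓ LinearMap.ker (leftAct (f - a • Coalgebra.counit)) = S := by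
      refine hmin _ inf_le_left (isRightCoideal_inf hS (isRightCoideal_ker _)) ?_
      refine (Submodule.ne_bot_iff _).2 ⟨s, ⟨s.2, ?_⟩, fun h => hs.2 (Subtype.ext h)⟩
      rw [SetLike.mem_coe, LinearMap.mem_ker, leftAct_sub, leftAct_smul, leftAct_counit, hs1, sub_self]
    intro x hx
    have := congrArg (Coalgebra.counit (R := k)) (LinearMap.mem_ker.1 (inf_eq_left.1 hle hx))
    rw [counit_leftAct, map_zero] at this
    simpa [sub_eq_zero] using this
  obtain ⟨s, hs, hs0⟩ := Submodule.exists_mem_ne_zero_of_ne_bot hS0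
  have hε : Coalgebra.counit (R := k) s ≠ 0 := by
    intro hε
    refine hs0 ((Module.forall_dual_apply_eq_zero_iff k s).1 fun f => ?_)
    obtain ⟨a, ha⟩ := hscal f
    rw [ha s hs, hε, mul_zero]
  have hSs : S = k ∙ s := by
    refine le_antisymm (fun t ht => ?_) ((Submodule.span_singleton_le_iff_mem _ _).2 hs)
    refine Submodule.mem_span_singleton.2
      ⟨Coalgebra.counit (R := k) t / Coalgebra.counit (R := k) s, ?_⟩
    refine eq_of_forall_dual (k := k) fun f => ?_
    obtain ⟨a, ha⟩ := hscal f
    rw [map_smul, ha s hs, ha t ht, smul_eq_mul]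
    field_simp
  obtain ⟨g, hgS, hg⟩ := exists_isGroupLikeElem_of_span (hSs ▸ hS) hs0
  exact ⟨g, hSN (hSs ▸ hgS), hg⟩

/-- Group-likes are prime for sums of right coideals. Compactness of `k ∙ g` leaves a finite sum,
and distributivity splits the line `k ∙ g` over the summands, one of which must meet it. -/
theorem exists_mem_of_mem_sSup (hC : IsDistributiveCoalgebra k C) {g : C}
    (hg : IsGroupLikeElem k g) {𝒩 : Set (Submodule k C)} (h𝒩 : ∀ N ∈ 𝒩, IsRightCoideal k C N)
    (hmem : g ∈ sSup 𝒩) : ∃ N ∈ 𝒩, g ∈ N := by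
  classical
  obtain ⟨s, hs𝒩, hs⟩ : ∃ s : Finset (Submodule k C), (s : Set (Submodule k C)) ⊆ 𝒩 ∧
      g ∈ s.sup id := by
    obtain ⟨s, hs, hle⟩ := (CompleteLattice.isCompactElement_iff_exists_le_sSup_of_le_sSup _ _).1
      (Submodule.singleton_span_isCompactElement g) 𝒩
      ((Submodule.span_singleton_le_iff_mem _ _).2 hmem)
    exact ⟨s, hs, (Submodule.span_singleton_le_iff_mem _ _).1 hle⟩
  suffices ∃ N ∈ s, g ∈ N by
    obtain ⟨N, hN, hgN⟩ := this
    exact ⟨N, hs𝒩 hN, hgN⟩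
  induction s using Finset.induction_on with
  | empty =>
    simp only [Finset.sup_empty, Submodule.mem_bot] at hs
    exact absurd hs hg.ne_zero
  | insert N s hNs ih =>
    rw [Finset.coe_insert, Set.insert_subset_iff] at hs𝒩
    rw [Finset.sup_insert, id_eq] at hs
    have hN := h𝒩 N hs𝒩.1
    have hL : IsRightCoideal k C (s.sup id) := by
      rw [Finset.sup_id_eq_sSup]
      exact isRightCoideal_sSup fun L hL => h𝒩 L (hs𝒩.2 hL)
    have hmem' : g ∈ (k ∙ g) ⊓ (N ⊔ s.sup id) := ⟨Submodule.mem_span_singleton_self g, hs⟩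
    rw [inf_sup_eq hC (isRightCoideal_span hg) hN hL] at hmem'
    by_cases h1 : N ⊓ (k ∙ g) = ⊥
    · by_cases h2 : s.sup id ⊓ (k ∙ g) = ⊥
      · rw [inf_comm, h1, inf_comm, h2, bot_sup_eq, Submodule.mem_bot] at hmem'
        exact absurd hmem' hg.ne_zero
      · obtain ⟨M, hM, hgM⟩ := ih hs𝒩.2 (mem_of_inf_span_ne_bot h2)
        exact ⟨M, Finset.mem_insert_of_mem hM, hgM⟩
    · exact ⟨N, Finset.mem_insert_self _ _, mem_of_inf_span_ne_bot h1⟩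

variable (k) in
/-- The sum of all right coideals whose only group-like element is `g`. -/
def component (g : C) : Submodule k C :=
  sSup {N | IsRightCoideal k C N ∧ ∀ h ∈ N, IsGroupLikeElem k h → h = g}

theorem isRightCoideal_component (g : C) : IsRightCoideal k C (component k g) :=
  isRightCoideal_sSup fun _ hN => hN.1

theorem le_component {N : Submodule k C} (hN : IsRightCoideal k C N) {g : C}
    (h : ∀ h ∈ N, IsGroupLikeElem k h → h = g) : N ≤ component k g :=
  le_sSup (a := N) ⟨hN, h⟩

theorem eq_of_mem_component (hC : IsDistributiveCoalgebra k C) {g h : C}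
    (hh : IsGroupLikeElem k h) (hmem : h ∈ component k g) : h = g := by
  obtain ⟨N, hN, hhN⟩ := exists_mem_of_mem_sSup hC hh (fun N hN => hN.1) hmem
  exact hN.2 h hhN hh

theorem mem_component_self {g : C} (hg : IsGroupLikeElem k g) : g ∈ component k g :=
  le_component (isRightCoideal_span hg) (fun _ hm hh => eq_of_mem_span_of_isGroupLikeElem hg hh hm)
    (Submodule.mem_span_singleton_self g)

/-- A group-like `h ≠ g` in the image would span a line disjoint from the component, and
`map_leftAct_inf_map_leftAct` with `f` and `ε` would make that line disjoint from the image too. -/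
theorem map_leftAct_component_le (hC : IsDistributiveCoalgebra k C) (g : C) (f : C →ₗ[k] k) :
    (component k g).map (leftAct f) ≤ component k g := by
  have hX := isRightCoideal_component (k := k) g
  refine le_component (isRightCoideal_map hX f) fun h hm hh => ?_
  by_contra hne
  have hz : ∀ l : C →ₗ[k] k, ∀ x ∈ component k g ⊓ (k ∙ h), l x = 0 := by
    intro l x hx
    have hbot : component k g ⊓ (k ∙ h) = ⊥ := by
      by_contra hbot
      exact hne (eq_of_mem_component hC hh (mem_of_inf_span_ne_bot hbot))
    rw [hbot, Submodule.mem_bot] at hx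
    rw [hx, map_zero]
  have := map_leftAct_inf_map_leftAct hC hX (isRightCoideal_span hh) (hz f) (hz Coalgebra.counit)
  rw [map_leftAct_counit] at this
  have hm' : h ∈ (component k g).map (leftAct f) ⊓ (k ∙ h) :=
    ⟨hm, Submodule.mem_span_singleton_self h⟩
  rw [this, Submodule.mem_bot] at hm'
  exact hh.ne_zero hm'

/-- In a distributive coalgebra the component of `g` is a subcoalgebra. -/
def componentSubcoalgebra (hC : IsDistributiveCoalgebra k C) (g : C) : Subcoalgebra k C :=
  subcoalgebraOfStable (component k g) (isRightCoideal_component g)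
    fun f x hx => map_leftAct_component_le hC g f ⟨x, hx, rfl⟩

/-- Right coideals inside a component are linearly ordered. -/
theorem le_or_le_of_le_component (hC : IsDistributiveCoalgebra k C)
    (hgl : ∀ N : Submodule k C, IsRightCoideal k C N → N ≠ ⊥ → ∃ g ∈ N, IsGroupLikeElem k g)
    {g : C} {X Y : Submodule k C} (hX : IsRightCoideal k C X) (hY : IsRightCoideal k C Y)
    (hXg : X ≤ component k g) (hYg : Y ≤ component k g) : X ≤ Y ∨ Y ≤ X := by
  by_contra! hne
  -- A form vanishing on `X ⊓ Y` but not on `Z` has a nonzero image of `Z` inside the component,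
  -- which therefore contains `g`. For incomparable `X` and `Y` the two images would share `g`,
  -- against `map_leftAct_inf_map_leftAct`.
  have key : ∀ {Z : Submodule k C}, IsRightCoideal k C Z → Z ≤ component k g → ¬ Z ≤ X ⊓ Y →
      ∃ f : C →ₗ[k] k, (∀ x ∈ X ⊓ Y, f x = 0) ∧ g ∈ Z.map (leftAct f) := by
    intro Z hZ hZg hle
    obtain ⟨z, hz, hzn⟩ := Set.not_subset.1 hle
    obtain ⟨f, hfz, hf⟩ := Submodule.exists_dual_map_eq_bot_of_notMem hzn inferInstance
    refine ⟨f, fun x hx => ?_, ?_⟩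
    · have : f x ∈ (X ⊓ Y).map f := ⟨x, hx, rfl⟩
      rw [hf] at this
      exact (Submodule.mem_bot k).1 this
    · obtain ⟨h, hh, hhg⟩ := hgl _ (isRightCoideal_map hZ f)
        ((Submodule.ne_bot_iff _).2 ⟨leftAct f z, ⟨z, hz, rfl⟩, fun h0 => hfz (by
          rw [← counit_leftAct, h0, map_zero])⟩)
      rwa [← eq_of_mem_component hC hhg
        (map_leftAct_component_le hC g f (Submodule.map_mono hZg hh))]
  obtain ⟨f, hf, hfg⟩ := key hX hXg fun h => hne.1 (h.trans inf_le_right)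
  obtain ⟨f', hf', hfg'⟩ := key hY hYg fun h => hne.2 (h.trans inf_le_left)
  have hbot : g ∈ X.map (leftAct f) ⊓ Y.map (leftAct f') := ⟨hfg, hfg'⟩
  rw [map_leftAct_inf_map_leftAct hC hX hY hf hf', Submodule.mem_bot] at hbot
  have hX0 : X ≠ ⊥ := by
    rintro rfl
    exact hne.1 bot_le
  obtain ⟨h, hh, hhg⟩ := hgl X hX hX0
  exact hhg.ne_zero ((eq_of_mem_component hC hhg (hXg hh)).trans hbot)

/-- A nonzero intersection would contain a group-like, which by primality lies in a single other
component and so equals two different elements. -/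
theorem iSupIndep_component (hC : IsDistributiveCoalgebra k C)
    (hgl : ∀ N : Submodule k C, IsRightCoideal k C N → N ≠ ⊥ → ∃ g ∈ N, IsGroupLikeElem k g) :
    iSupIndep fun g : {g : C // IsGroupLikeElem k g} => component k (g : C) := by
  intro g
  rw [disjoint_iff]
  let 𝒩 : Set (Submodule k C) :=
    {N | ∃ h : {g : C // IsGroupLikeElem k g}, h ≠ g ∧ component k (h : C) = N}
  have h𝒩 : ∀ N ∈ 𝒩, IsRightCoideal k C N := by
    rintro _ ⟨h, -, rfl⟩
    exact isRightCoideal_component _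
  have hle : (⨆ (h) (_ : h ≠ g), component k (h : C)) ≤ sSup 𝒩 :=
    iSup₂_le fun h hne => le_sSup (a := component k (h : C)) ⟨h, hne, rfl⟩
  refine eq_bot_mono (inf_le_inf_left _ hle) ?_
  by_contra h0
  obtain ⟨h, ⟨hh1, hh2⟩, hh⟩ := hgl _
    (isRightCoideal_inf (isRightCoideal_component _) (isRightCoideal_sSup h𝒩)) h0
  obtain ⟨_, ⟨h', hne, rfl⟩, hm⟩ := exists_mem_of_mem_sSup hC hh h𝒩 hh2
  exact hne (Subtype.ext ((eq_of_mem_component hC hh hm).symm.trans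
    (eq_of_mem_component hC hh hh1)))

/-- For every group-like `g` there is a linear form `f` with `f g = 1` that maps the whole
coalgebra to the component of `g`. -/
theorem exists_range_leftAct_le_component (hC : IsDistributiveCoalgebra k C) {g : C}
    (hg : IsGroupLikeElem k g) :
    ∃ f : C →ₗ[k] k, f g = 1 ∧ ∀ x, leftAct f x ∈ component k g := by
  -- By primality the sum of all right coideals avoiding `g` still avoids `g`, so some `f` vanishes
  -- on it with `f g ≠ 0`.
  let 𝒩 : Set (Submodule k C) := {N | IsRightCoideal k C N ∧ g ∉ N}
  have hY : IsRightCoideal k C (sSup 𝒩) := isRightCoideal_sSup fun _ hN => hN.1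
  have hgY : g ∉ sSup 𝒩 := by
    intro hmem
    obtain ⟨N, hN, hgN⟩ := exists_mem_of_mem_sSup hC hg (fun N hN => hN.1) hmem
    exact hN.2 hgN
  obtain ⟨f, hfg, hf⟩ := Submodule.exists_dual_map_eq_bot_of_notMem hgY inferInstance
  have hf0 : ∀ x ∈ sSup 𝒩, f x = 0 := by
    intro x hx
    have : f x ∈ (sSup 𝒩).map f := ⟨x, hx, rfl⟩
    rw [hf] at this
    exact (Submodule.mem_bot k).1 this
  refine ⟨(f g)⁻¹ • f, by simp [inv_mul_cancel₀ hfg], fun x => ?_⟩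
  rw [leftAct_smul]
  refine Submodule.smul_mem _ _ ?_
  refine le_component (N := (⊤ : Submodule k C).map (leftAct f))
    (isRightCoideal_map isRightCoideal_top f) ?_ ⟨x, trivial, rfl⟩
  rintro h ⟨y, -, hy⟩ hh
  have hZ : IsRightCoideal k C ((k ∙ h).comap (leftAct f)) :=
    isRightCoideal_comap (isRightCoideal_span hh) f
  have hgZ : g ∈ (k ∙ h).comap (leftAct f) := by
    -- Were `g` outside the preimage of `k ∙ h`, this preimage would lie in the sum on which `f`
    -- vanishes, so `leftAct f` would kill it and `h` would be zero.
    by_contra hgZ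
    have hyZ : y ∈ (k ∙ h).comap (leftAct f) := by
      rw [Submodule.mem_comap, hy]
      exact Submodule.mem_span_singleton_self h
    have hle : (k ∙ h).comap (leftAct f) ≤ sSup 𝒩 := le_sSup (a := _) ⟨hZ, hgZ⟩
    exact hh.ne_zero (hy.symm.trans (leftAct_eq_zero hY hf0 (hle hyZ)))
  rw [Submodule.mem_comap, leftAct_of_isGroupLikeElem hg] at hgZ
  exact (eq_of_mem_span_of_isGroupLikeElem hh hg ((Submodule.smul_mem_iff _ hfg).1 hgZ)).symm

/-- Induct on the dimension of a right coideal `X` containing a group-like `g`: split `x = leftAct f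
x + leftAct (ε - f) x`. The first term lies in the component of `g`; the second lies in an image of
`X` of smaller dimension, since `g` is killed. -/
theorem iSup_component (hC : IsDistributiveCoalgebra k C)
    (hgl : ∀ N : Submodule k C, IsRightCoideal k C N → N ≠ ⊥ → ∃ g ∈ N, IsGroupLikeElem k g) :
    ⨆ g : {g : C // IsGroupLikeElem k g}, component k (g : C) = ⊤ := by
  have key : ∀ n, ∀ X : Submodule k C, IsRightCoideal k C X → Module.Finite k X →
      Module.finrank k X ≤ n → X ≤ ⨆ g : {g : C // IsGroupLikeElem k g}, component k (g : C) := by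
    intro n
    induction n with
    | zero =>
      intro X _ _ hr
      rw [Submodule.finrank_eq_zero.1 (Nat.le_zero.1 hr)]
      exact bot_le
    | succ n ih =>
      intro X hX hfin hr
      by_cases h0 : X = ⊥
      · rw [h0]
        exact bot_le
      obtain ⟨g, hgX, hg⟩ := hgl X hX h0
      obtain ⟨f, hfg, hf⟩ := exists_range_leftAct_le_component hC hg
      set f' : C →ₗ[k] k := Coalgebra.counit - f with hf'
      have hker : LinearMap.ker ((leftAct f').domRestrict X) ≠ ⊥ := by
        intro hbot
        have hmem : (⟨g, hgX⟩ : X) ∈ LinearMap.ker ((leftAct f').domRestrict X) := by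
          rw [LinearMap.mem_ker, LinearMap.domRestrict_apply, leftAct_of_isGroupLikeElem hg]
          simp [hf', hfg, hg.counit_eq_one]
        rw [hbot, Submodule.mem_bot] at hmem
        exact hg.ne_zero (congrArg Subtype.val hmem)
      have h1 := LinearMap.finrank_range_add_finrank_ker ((leftAct f').domRestrict X)
      rw [LinearMap.range_domRestrict] at h1
      have h2 := Submodule.one_le_finrank_iff.2 hker
      have h3 := ih _ (isRightCoideal_map hX f') inferInstance (by omega)
      intro x hx
      have hsum : x = leftAct f x + leftAct f' x := by
        rw [hf', leftAct_sub, leftAct_counit, add_sub_cancel]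
      rw [hsum]
      exact Submodule.add_mem _
        (le_iSup (fun g : {g : C // IsGroupLikeElem k g} => component k (g : C)) ⟨g, hg⟩ (hf x))
        (h3 ⟨x, hx, rfl⟩)
  rw [eq_top_iff]
  intro x _
  exact key _ _ (isRightCoideal_gen x) inferInstance le_rfl (mem_gen_self x)

theorem isChainCoalgebra_componentSubcoalgebra (hC : IsDistributiveCoalgebra k C)
    (hgl : ∀ N : Submodule k C, IsRightCoideal k C N → N ≠ ⊥ → ∃ g ∈ N, IsGroupLikeElem k g)
    {g : C} (hg : IsGroupLikeElem k g) :
    IsChainCoalgebra k (componentSubcoalgebra hC g).toSubmodule where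
  nontrivial := ⟨⟨⟨g, mem_component_self hg⟩, 0, fun h => hg.ne_zero (congrArg Subtype.val h)⟩⟩
  le_or_le := by
    rintro ⟨N, hN⟩ ⟨L, hL⟩
    have hinj := inclusion_injective (componentSubcoalgebra hC g)
    have hle : ∀ M : Submodule k (componentSubcoalgebra hC g).toSubmodule,
        M.map (inclusion (componentSubcoalgebra hC g)).toLinearMap ≤ component k g := by
      rintro M _ ⟨x, -, rfl⟩
      exact x.2
    refine (le_or_le_of_le_component hC hgl ((isRightCoideal_map_coalgHom hinj).2 hN)
      ((isRightCoideal_map_coalgHom hinj).2 hL) (hle N) (hle L)).imp ?_ ?_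
    · exact (Submodule.map_le_map_iff_of_injective hinj _ _).1
    · exact (Submodule.map_le_map_iff_of_injective hinj _ _).1

theorem exists_isGroupLikeElem_subcoalgebra (D : Subcoalgebra k C)
    (hgl : ∀ N : Submodule k C, IsRightCoideal k C N → N ≠ ⊥ → ∃ g ∈ N, IsGroupLikeElem k g)
    {N : Submodule k D.toSubmodule} (hN : IsRightCoideal k D.toSubmodule N) (h0 : N ≠ ⊥) :
    ∃ g ∈ N, IsGroupLikeElem k g := by
  have hinj := inclusion_injective D
  obtain ⟨_, ⟨g, hgN, rfl⟩, hg⟩ := hgl _ ((isRightCoideal_map_coalgHom hinj).2 hN)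
    (fun h => h0 (Submodule.map_injective_of_injective hinj (h.trans (Submodule.map_bot _).symm)))
  exact ⟨g, hgN, isGroupLikeElem_of_coalgHom hinj hg⟩

end Distributive

/-! ### Right coideals of the divided power coalgebra -/

section DividedPowers

variable {k : Type u} [Field k]

theorem dividedPower_eq_sum {y : DividedPower k} {n : ℕ}
    (hy : ∀ m, n ≤ m → (DividedPower.c k).repr y m = 0) :
    y = ∑ j ∈ Finset.range n, (DividedPower.c k).repr y j • DividedPower.c k j := by
  refine (DividedPower.c k).repr.injective ?_
  ext i
  rw [map_sum, Finset.sum_apply']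
  simp only [map_smul, Module.Basis.repr_self, Finsupp.smul_apply, smul_eq_mul,
    Finsupp.single_apply, mul_ite, mul_one, mul_zero, Finset.sum_ite_eq', Finset.mem_range]
  split_ifs with h
  · rfl
  · exact hy i (not_lt.1 h)

theorem repr_rightAct_coord (m : ℕ) (y : DividedPower k) (i : ℕ) :
    (DividedPower.c k).repr (rightAct ((DividedPower.c k).coord m) y) i =
      (DividedPower.c k).repr y (i + m) := by
  rw [← tensorProduct_repr_comul, rightAct_apply]
  generalize (Coalgebra.comul y : DividedPower k ⊗[k] DividedPower k) = z
  induction z using TensorProduct.induction_on with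
  | zero => simp
  | tmul a b => simp [Module.Basis.tensorProduct_repr_tmul_apply]
  | add a b ha hb => simp only [map_add, Finsupp.add_apply, ha, hb]

/-- Acting by the coordinate form of `c (n - i)` shifts indices down by `n - i`, giving an element
of `N` of degree `i` with the same leading coefficient. Its lower terms are in `N` by induction. -/
theorem c_mem_of_degree {N : Submodule k (DividedPower k)} (hN : IsRightCoideal k _ N)
    {y : DividedPower k} (hy : y ∈ N) {n : ℕ} (hn : (DividedPower.c k).repr y n ≠ 0)
    (hmax : ∀ m, n < m → (DividedPower.c k).repr y m = 0) (i : ℕ) (hi : i ≤ n) :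
    DividedPower.c k i ∈ N := by
  induction i using Nat.strong_induction_on with
  | _ i ih =>
    set z := rightAct ((DividedPower.c k).coord (n - i)) y with hz
    have hzN : z ∈ N := isRightCoideal_iff.1 hN _ y hy
    have hzr : ∀ j, (DividedPower.c k).repr z j = (DividedPower.c k).repr y (j + (n - i)) :=
      repr_rightAct_coord (n - i) y
    have hsum := dividedPower_eq_sum (y := z) (n := i + 1) fun m hm => by
      rw [hzr]
      exact hmax _ (by omega)
    rw [Finset.sum_range_succ] at hsum
    have hlow : ∑ j ∈ Finset.range i, (DividedPower.c k).repr z j • DividedPower.c k j ∈ N :=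
      Submodule.sum_mem _ fun j hj => N.smul_mem _
        (ih j (Finset.mem_range.1 hj) (by have := Finset.mem_range.1 hj; omega))
    rw [hsum, N.add_mem_iff_right hlow, hzr, Nat.add_sub_cancel' hi] at hzN
    exact (N.smul_mem_iff hn).1 hzN

theorem exists_degree {y : DividedPower k} {m : ℕ} (hy : (DividedPower.c k).repr y m ≠ 0) :
    ∃ n, m ≤ n ∧ (DividedPower.c k).repr y n ≠ 0 ∧
      ∀ j, n < j → (DividedPower.c k).repr y j = 0 := by
  have hm : m ∈ ((DividedPower.c k).repr y).support := Finsupp.mem_support_iff.2 hy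
  refine ⟨((DividedPower.c k).repr y).support.max' ⟨m, hm⟩, Finset.le_max' _ _ hm,
    Finsupp.mem_support_iff.1 (Finset.max'_mem _ _), fun j hj => ?_⟩
  by_contra hne
  exact absurd (Finset.le_max' _ _ (Finsupp.mem_support_iff.2 hne)) (not_le.2 hj)

theorem c_mem_of_repr_ne_zero {N : Submodule k (DividedPower k)} (hN : IsRightCoideal k _ N)
    {y : DividedPower k} (hy : y ∈ N) {m : ℕ} (hm : (DividedPower.c k).repr y m ≠ 0) {i : ℕ}
    (hi : i ≤ m) : DividedPower.c k i ∈ N := by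
  obtain ⟨n, hmn, hn, hmax⟩ := exists_degree hm
  exact c_mem_of_degree hN hy hn hmax i (hi.trans hmn)

theorem mem_of_forall_c_mem {N : Submodule k (DividedPower k)} {y : DividedPower k}
    (h : ∀ i, (DividedPower.c k).repr y i ≠ 0 → DividedPower.c k i ∈ N) : y ∈ N := by
  rw [← (DividedPower.c k).linearCombination_repr y, Finsupp.linearCombination_apply]
  exact Submodule.sum_mem _ fun i hi => N.smul_mem _ (h i (Finsupp.mem_support_iff.1 hi))

/-- A right coideal is spanned by the `cᵢ` it contains, and their indices form an initial segment of
`ℕ`; initial segments are comparable. -/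
theorem dividedPower_le_or_le {N L : Submodule k (DividedPower k)}
    (hN : IsRightCoideal k _ N) (hL : IsRightCoideal k _ L) : N ≤ L ∨ L ≤ N := by
  by_contra! hne
  obtain ⟨y, hyN, hyL⟩ := Set.not_subset.1 hne.1
  obtain ⟨z, hzL, hzN⟩ := Set.not_subset.1 hne.2
  obtain ⟨i, hi, hiL⟩ : ∃ i, (DividedPower.c k).repr y i ≠ 0 ∧ DividedPower.c k i ∉ L := by
    by_contra! h
    exact hyL (mem_of_forall_c_mem h)
  obtain ⟨j, hj, hjN⟩ : ∃ j, (DividedPower.c k).repr z j ≠ 0 ∧ DividedPower.c k j ∉ N := by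
    by_contra! h
    exact hzN (mem_of_forall_c_mem h)
  rcases le_total i j with hij | hij
  · exact hiL (c_mem_of_repr_ne_zero hL hzL hj hij)
  · exact hjN (c_mem_of_repr_ne_zero hN hyN hi hij)

theorem c_zero_mem {N : Submodule k (DividedPower k)} (hN : IsRightCoideal k _ N) (h0 : N ≠ ⊥) :
    DividedPower.c k 0 ∈ N := by
  obtain ⟨y, hy, hy0⟩ := Submodule.exists_mem_ne_zero_of_ne_bot h0
  obtain ⟨m, hm⟩ : ∃ m, (DividedPower.c k).repr y m ≠ 0 := by
    by_contra! h
    exact hy0 ((DividedPower.c k).repr.injective (by ext i; simp [h i]))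
  exact c_mem_of_repr_ne_zero hN hy hm (Nat.zero_le m)

theorem isGroupLikeElem_c_zero : IsGroupLikeElem k (DividedPower.c k 0) where
  counit_eq_one := by simp [DividedPower.counit_c]
  comul_eq_tmul_self := by
    refine ((DividedPower.c k).tensorProduct (DividedPower.c k)).repr.injective ?_
    ext ⟨i, j⟩
    rw [tensorProduct_repr_comul]
    by_cases hi : i = 0
    · simp [hi, Module.Basis.tensorProduct_repr_tmul_apply, Finsupp.single_apply]
    · simp [hi, Module.Basis.tensorProduct_repr_tmul_apply, Finsupp.single_apply]

/-- A right coideal of the divided power coalgebra is everything or the span of `c₀, …, cₙ₋₁`. -/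
theorem eq_top_or_exists_mem_iff {N : Submodule k (DividedPower k)} (hN : IsRightCoideal k _ N) :
    N = ⊤ ∨ ∃ n, ∀ y, y ∈ N ↔ ∀ m, n ≤ m → (DividedPower.c k).repr y m = 0 := by
  classical
  by_cases hall : ∀ n, DividedPower.c k n ∈ N
  · exact Or.inl (eq_top_iff.2 fun y _ => mem_of_forall_c_mem fun i _ => hall i)
  · push Not at hall
    refine Or.inr ⟨Nat.find hall, fun y => ⟨fun hy m hm => ?_, fun hy => ?_⟩⟩
    · by_contra hne
      exact Nat.find_spec hall (c_mem_of_repr_ne_zero hN hy hne hm)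
    · refine mem_of_forall_c_mem fun i hi => ?_
      by_contra hiN
      exact hi (hy i (Nat.find_min' hall hiN))

variable {C : Type*} [AddCommGroup C] [Module k C] [Coalgebra k C]

theorem isChainCoalgebra_of_injective [Nontrivial C] {φ : C →ₗc[k] DividedPower k}
    (hφ : Function.Injective φ) : IsChainCoalgebra k C where
  nontrivial := inferInstance
  le_or_le := by
    rintro ⟨N, hN⟩ ⟨L, hL⟩
    refine (dividedPower_le_or_le ((isRightCoideal_map_coalgHom hφ).2 hN)
      ((isRightCoideal_map_coalgHom hφ).2 hL)).imp ?_ ?_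
    · exact (Submodule.map_le_map_iff_of_injective hφ _ _).1
    · exact (Submodule.map_le_map_iff_of_injective hφ _ _).1

/-- The image of a nonzero subcoalgebra contains `c 0`, so the subcoalgebra contains a group-like
line, to which a simple one must be equal. -/
theorem isPointedCoalgebra_of_injective {φ : C →ₗc[k] DividedPower k}
    (hφ : Function.Injective φ) : IsPointedCoalgebra k C := by
  rintro D ⟨hD0, hD⟩
  obtain ⟨g, hgD, hgφ⟩ := c_zero_mem
    ((isRightCoideal_map_coalgHom hφ).2 (isRightCoideal_subcoalgebra D))
    (fun h => hD0 (Submodule.map_injective_of_injective hφ (h.trans (Submodule.map_bot _).symm)))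
  have hg : IsGroupLikeElem k g := isGroupLikeElem_of_coalgHom hφ
    ((show φ g = DividedPower.c k 0 from hgφ) ▸ isGroupLikeElem_c_zero)
  let E : Subcoalgebra k C := subcoalgebraOfStable (k ∙ g) (isRightCoideal_span hg) (by
    intro f x hx
    obtain ⟨a, rfl⟩ := Submodule.mem_span_singleton.1 hx
    rw [map_smul, leftAct_of_isGroupLikeElem hg]
    exact Submodule.smul_mem _ _ (Submodule.smul_mem _ _ (Submodule.mem_span_singleton_self g)))
  rcases hD E ((Submodule.span_singleton_le_iff_mem _ _).2 hgD) with h | h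
  · exact absurd (Submodule.span_singleton_eq_bot.1 h) hg.ne_zero
  · rw [← h]
    exact finrank_span_singleton hg.ne_zero

end DividedPowers

/-! ### Finite duals of truncated polynomial and power series rings -/

section FiniteDuals

variable {k : Type u} [Field k] {A : Type*} [Ring A] [Algebra k A]

/-- Evaluation at `x` as a linear form on the finite dual. -/
def evalForm (x : A) : finiteDual k A →ₗ[k] k :=
  LinearMap.applyₗ x ∘ₗ (finiteDual k A).subtype

theorem leftAct_evalForm (x : A) (f : finiteDual k A) (b : A) :
    (leftAct (C := finiteDual k A) (evalForm x) f).1 b = f.1 (x * b) := by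
  have h : ∀ z : finiteDual k A ⊗[k] finiteDual k A,
      (TensorProduct.lid k _ (LinearMap.rTensor _ (evalForm x) z)).1 b =
        finiteDual.pairing k A z (x ⊗ₜ b) := by
    intro z
    induction z using TensorProduct.induction_on with
    | zero => simp
    | tmul g h => simp [evalForm]
    | add y z hy hz => simp only [map_add, LinearMap.add_apply, ← hy, ← hz, Submodule.coe_add]
  rw [leftAct_apply, h]
  change finiteDual.pairing k A (finiteDual.comulAux k A f) (x ⊗ₜ b) = _
  rw [finiteDual.pairing_comulAux, LinearMap.comp_apply, LinearMap.mul'_apply]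

theorem leftAct_evalForm_pow (x : A) (n : ℕ) (f : finiteDual k A) (b : A) :
    ((leftAct (C := finiteDual k A) (evalForm x) ^ n) f).1 b = f.1 (x ^ n * b) := by
  induction n generalizing b with
  | zero => simp
  | succ n ih => rw [pow_succ', Module.End.mul_apply, leftAct_evalForm, ih, pow_succ, mul_assoc]

theorem exists_leftAct_evalForm_pow_eq_zero {x : A}
    (hx : ∀ f : finiteDual k A, ∃ n, ∀ b, f.1 (x ^ n * b) = 0) (f : finiteDual k A) :
    ∃ n, (leftAct (C := finiteDual k A) (evalForm x) ^ n) f = 0 := by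
  obtain ⟨n, hn⟩ := hx f
  refine ⟨n, Subtype.ext (LinearMap.ext fun b => ?_)⟩
  rw [leftAct_evalForm_pow, hn]
  simp

/-- Evaluation at `x` acts on `A°` by `f ↦ f (x * ·)`, so `toDividedPower` becomes `f ↦ ∑ f(xⁿ) cₙ`.
-/
theorem exists_finiteDual_toDividedPower {x : A}
    (hx : ∀ f : finiteDual k A, ∃ n, ∀ b, f.1 (x ^ n * b) = 0)
    (hinj : ∀ f : finiteDual k A, (∀ n, f.1 (x ^ n) = 0) → f = 0) :
    ∃ φ : finiteDual k A →ₗc[k] DividedPower k, Function.Injective φ ∧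
      ∀ f n, (DividedPower.c k).repr (φ f) n = f.1 (x ^ n) := by
  have hr : ∀ f n, (DividedPower.c k).repr
      (toDividedPower (C := finiteDual k A) (evalForm x)
        (exists_leftAct_evalForm_pow_eq_zero hx) f) n =
      f.1 (x ^ n) := by
    intro f n
    rw [repr_toDividedPower]
    exact (leftAct_evalForm_pow x n f 1).trans (by rw [mul_one])
  refine ⟨toDividedPower (C := finiteDual k A) (evalForm x)
    (exists_leftAct_evalForm_pow_eq_zero hx), ?_, hr⟩
  rw [injective_iff_map_eq_zero]
  intro f hf
  refine hinj f fun n => ?_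
  rw [← hr, hf]
  simp

open Polynomial in
theorem exists_truncated_toDividedPower (n : ℕ) :
    ∃ φ : finiteDual k (k[X] ⧸ Ideal.span {(X : k[X]) ^ n}) →ₗc[k] DividedPower k,
      Function.Injective φ ∧ ∀ y, y ∈ LinearMap.range φ.toLinearMap ↔
        ∀ m, n ≤ m → (DividedPower.c k).repr y m = 0 := by
  set I : Ideal k[X] := Ideal.span {(X : k[X]) ^ n} with hI
  let x : k[X] ⧸ I := Ideal.Quotient.mk I X
  have hx : ∀ m, n ≤ m → x ^ m = 0 := by
    intro m hm
    rw [← map_pow, Ideal.Quotient.eq_zero_iff_mem, hI, Ideal.mem_span_singleton]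
    exact pow_dvd_pow X hm
  obtain ⟨φ, hφ, hr⟩ := exists_finiteDual_toDividedPower (k := k) (x := x)
    (fun f => ⟨n, fun b => by rw [hx n le_rfl, zero_mul, map_zero]⟩) (fun f hf => by
      have h0 : f.1 ∘ₗ (Ideal.Quotient.mkₐ k I).toLinearMap = 0 := by
        refine Polynomial.lhom_ext' fun m => LinearMap.ext_ring ?_
        have : Ideal.Quotient.mk I (monomial m (1 : k)) = x ^ m := by
          rw [monomial_one_right_eq_X_pow, map_pow]
        simpa [this] using hf m
      refine Subtype.ext (LinearMap.ext fun a => ?_)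
      obtain ⟨p, rfl⟩ := Ideal.Quotient.mk_surjective a
      exact LinearMap.congr_fun h0 p)
  refine ⟨φ, hφ, fun y => ⟨?_, fun hy => ?_⟩⟩
  · rintro ⟨f, rfl⟩ m hm
    exact (hr f m).trans (by rw [hx m hm, map_zero])
  -- The form with prescribed values on `1, X, …, Xⁿ⁻¹`; it reads only coefficients below `n`, so it
  -- descends to the quotient.
  · let g : k[X] →ₗ[k] k := ∑ j ∈ Finset.range n, (DividedPower.c k).repr y j • lcoeff k j
    have hg : I.restrictScalars k ≤ LinearMap.ker g := by
      intro p hp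
      have hp' : p ∈ I := hp
      rw [hI, Ideal.mem_span_singleton, X_pow_dvd_iff] at hp'
      rw [LinearMap.mem_ker, LinearMap.sum_apply]
      refine Finset.sum_eq_zero fun j hj => ?_
      rw [LinearMap.smul_apply, lcoeff_apply, hp' j (Finset.mem_range.1 hj), smul_zero]
    have hfin : Module.Finite k (k[X] ⧸ I) :=
      (monic_X_pow (R := k) n).finite_quotient
    let f : finiteDual k (k[X] ⧸ I) :=
      ⟨(I.restrictScalars k).liftQ g hg ∘ₗ
        (Submodule.Quotient.restrictScalarsEquiv k I).symm.toLinearMap,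
        finiteDual_eq_top k (k[X] ⧸ I) ▸ Submodule.mem_top⟩
    refine ⟨f, (DividedPower.c k).repr.injective ?_⟩
    ext m
    refine (hr f m).trans ?_
    have : f.1 (x ^ m) = g (X ^ m) := by
      simp only [x, ← map_pow]
      rfl
    rw [this, LinearMap.sum_apply]
    simp only [LinearMap.smul_apply, lcoeff_apply, coeff_X_pow, smul_eq_mul, mul_ite, mul_one,
      mul_zero, Finset.sum_ite_eq', Finset.mem_range]
    split_ifs with h
    · rfl
    · exact (hy m (not_lt.1 h)).symm

/-- The ideal is nonzero because `k⟦X⟧` contains the infinite-dimensional `k[X]`, and nonzero ideals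
of this discrete valuation ring are generated by powers of `X`. -/
theorem exists_X_pow_mem {I : Ideal (PowerSeries k)}
    (hI : Module.Finite k (PowerSeries k ⧸ I.restrictScalars k)) :
    ∃ n, (PowerSeries.X : PowerSeries k) ^ n ∈ I := by
  have hne : I ≠ ⊥ := by
    rintro rfl
    have hbot : (⊥ : Ideal (PowerSeries k)).restrictScalars k = ⊥ := by
      ext x
      simp
    rw [hbot] at hI
    have : Module.Finite k (PowerSeries k) :=
      Module.Finite.equiv (Submodule.quotEquivOfEqBot (⊥ : Submodule k (PowerSeries k)) rfl)
    refine Polynomial.not_finite (R := k) (Module.Finite.of_injective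
      (Polynomial.coeToPowerSeries.algHom (R := k) k).toLinearMap fun p q h => ?_)
    refine Polynomial.coe_injective k ?_
    simpa [Polynomial.coeToPowerSeries.algHom_apply] using h
  obtain ⟨n, hn⟩ := IsDiscreteValuationRing.ideal_eq_span_pow_irreducible hne
    (PowerSeries.X_irreducible (R := k))
  exact ⟨n, hn ▸ Ideal.mem_span_singleton_self _⟩

theorem exists_powerSeries_toDividedPower :
    ∃ φ : finiteDual k (PowerSeries k) →ₗc[k] DividedPower k,
      Function.Injective φ ∧ LinearMap.range φ.toLinearMap = ⊤ := by
  have hX : ∀ f : finiteDual k (PowerSeries k), ∃ n, ∀ b,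
      f.1 ((PowerSeries.X : PowerSeries k) ^ n * b) = 0 := by
    rintro ⟨f, I, hI, hfin, hf⟩
    obtain ⟨n, hn⟩ := exists_X_pow_mem hfin
    exact ⟨n, fun b => hf _ (I.mul_mem_right b hn)⟩
  obtain ⟨φ, hφ, hr⟩ := exists_finiteDual_toDividedPower (k := k)
    (x := (PowerSeries.X : PowerSeries k)) hX (fun f hf => by
      obtain ⟨n, hn⟩ := hX f
      refine Subtype.ext (LinearMap.ext fun p => ?_)
      -- As `f` kills the multiples of `Xⁿ`, its value at a series is its value at a truncation,
      -- which the numbers `f(Xᵐ)` determine.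
      rw [PowerSeries.eq_X_pow_mul_shift_add_trunc n p, map_add, hn, zero_add]
      have h0 : f.1 ∘ₗ (Polynomial.coeToPowerSeries.algHom (R := k) k).toLinearMap = 0 := by
        refine Polynomial.lhom_ext' fun m => LinearMap.ext_ring ?_
        have := hf m
        simp [Polynomial.coeToPowerSeries.algHom_apply, this,
          ← PowerSeries.X_pow_eq]
      have := LinearMap.congr_fun h0 (p.trunc n)
      simpa [Polynomial.coeToPowerSeries.algHom_apply] using this)
  refine ⟨φ, hφ, eq_top_iff.2 fun y _ => mem_of_forall_c_mem fun n _ => ?_⟩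
  let I : Ideal (PowerSeries k) := Ideal.span {PowerSeries.X ^ (n + 1)}
  -- The `n`-th coefficient form vanishes on `⟨Xⁿ⁺¹⟩` and is the preimage of `c n`.
  have hmem : PowerSeries.coeff (R := k) n ∈ finiteDual k (PowerSeries k) := by
    refine ⟨I, inferInstance, ?_, fun p hp => ?_⟩
    · let ψ : PowerSeries k →ₗ[k] (Fin (n + 1) → k) :=
        LinearMap.pi fun i => PowerSeries.coeff (R := k) (i : ℕ)
      have hψ : LinearMap.ker ψ = I.restrictScalars k := by
        ext p
        rw [LinearMap.mem_ker, Submodule.restrictScalars_mem, Ideal.mem_span_singleton,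
          PowerSeries.X_pow_dvd_iff, funext_iff]
        exact ⟨fun h m hm => h ⟨m, hm⟩, fun h i => h i i.2⟩
      rw [← hψ]
      exact Module.Finite.equiv ψ.quotKerEquivRange.symm
    · rw [Ideal.mem_span_singleton, PowerSeries.X_pow_dvd_iff] at hp
      exact hp n (Nat.lt_succ_self n)
  refine ⟨⟨_, hmem⟩, (DividedPower.c k).repr.injective ?_⟩
  ext m
  refine (hr ⟨_, hmem⟩ m).trans ?_
  rw [Module.Basis.repr_self, Finsupp.single_apply, PowerSeries.coeff_X_pow]

theorem exists_injective_of_equiv_finiteDual {C : Type*} [AddCommGroup C] [Module k C]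
    [Coalgebra k C] {ψ : finiteDual k A →ₗc[k] DividedPower k} (hψ : Function.Injective ψ)
    (h0 : DividedPower.c k 0 ∈ LinearMap.range ψ.toLinearMap) (e : C ≃ₗc[k] finiteDual k A) :
    Nontrivial C ∧ ∃ φ : C →ₗc[k] DividedPower k, Function.Injective φ := by
  obtain ⟨b, hb⟩ := h0
  have : Nontrivial (finiteDual k A) := ⟨⟨b, 0, by
    rintro rfl
    exact (DividedPower.c k).ne_zero 0 (hb.symm.trans (map_zero _))⟩⟩
  exact ⟨e.toEquiv.nontrivial, ψ.comp e.toCoalgHom, hψ.comp e.toEquiv.injective⟩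

/-- The coalgebras embedded in the divided power coalgebra are the duals of truncated polynomial
rings and the finite dual of the power series ring. -/
theorem exists_injective_toDividedPower_iff {C : Type*} [AddCommGroup C] [Module k C]
    [Coalgebra k C] :
    (Nontrivial C ∧ ∃ φ : C →ₗc[k] DividedPower k, Function.Injective φ) ↔
      (∃ n : ℕ, 0 < n ∧ Nonempty (C ≃ₗc[k] finiteDual k
        (Polynomial k ⧸ Ideal.span {(Polynomial.X : Polynomial k) ^ n}))) ∨
      Nonempty (C ≃ₗc[k] finiteDual k (PowerSeries k)) := by
  constructor
  · rintro ⟨hC, φ, hφ⟩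
    have hR : IsRightCoideal k _ (LinearMap.range φ.toLinearMap) :=
      isRightCoideal_subcoalgebra (rangeSubcoalgebra φ)
    rcases eq_top_or_exists_mem_iff hR with h | ⟨n, hn⟩
    · obtain ⟨ψ, hψ, hr⟩ := exists_powerSeries_toDividedPower (k := k)
      have he := nonempty_equiv_of_range_eq_range (D := finiteDual k (PowerSeries k)) hφ hψ
        (h.trans hr.symm)
      exact Or.inr he
    · obtain ⟨ψ, hψ, hr⟩ := exists_truncated_toDividedPower (k := k) n
      have he := nonempty_equiv_of_range_eq_range
        (D := finiteDual k (Polynomial k ⧸ Ideal.span {(Polynomial.X : Polynomial k) ^ n})) hφ hψ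
        (Submodule.ext fun y => (hn y).trans (hr y).symm)
      refine Or.inl ⟨n, Nat.pos_of_ne_zero ?_, he⟩
      rintro rfl
      obtain ⟨x, hx⟩ := exists_ne (0 : C)
      refine hx (hφ ?_)
      rw [map_zero]
      refine (DividedPower.c k).repr.injective ?_
      ext m
      rw [(hn (φ x)).1 ⟨x, rfl⟩ m (Nat.zero_le m)]
      simp
  · rintro (⟨n, hn, ⟨e⟩⟩ | he)
    · obtain ⟨ψ, hψ, hr⟩ := exists_truncated_toDividedPower (k := k) n
      refine exists_injective_of_equiv_finiteDual hψ ((hr _).2 fun m hm => ?_) e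
      rw [Module.Basis.repr_self, Finsupp.single_apply, if_neg (by omega)]
    · obtain ⟨ψ, hψ, hr⟩ := exists_powerSeries_toDividedPower (k := k)
      exact exists_injective_of_equiv_finiteDual hψ (hr ▸ Submodule.mem_top) he.some

end FiniteDuals

/-! ### Direct sums of coalgebras -/

section DirectSums

variable {k : Type*} {ι : Type*} [Field k] [DecidableEq ι] {A : ι → Type*}
  [∀ i, AddCommGroup (A i)] [∀ i, Module k (A i)] [∀ i, Coalgebra k (A i)]
  {C : Type*} [AddCommGroup C] [Module k C] [Coalgebra k C]

variable (k A) in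
/-- The inclusion of a summand in a direct sum of coalgebras. -/
def singleHom (i : ι) : A i →ₗc[k] Π₀ i, A i where
  toLinearMap := DFinsupp.lsingle i
  counit_comp := DFinsupp.counit_comp_lsingle k ι A i
  map_comp_comul := (DFinsupp.comul_comp_lsingle k ι A i).symm

theorem singleHom_injective (i : ι) : Function.Injective (singleHom k A i) :=
  DFinsupp.single_injective

/-- The coalgebra homomorphism from a direct sum defined by homomorphisms on the summands. -/
def sumHom (ψ : ∀ i, A i →ₗc[k] C) : (Π₀ i, A i) →ₗc[k] C where
  toLinearMap := DFinsupp.lsum k fun i => (ψ i).toLinearMap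
  counit_comp := by
    refine DFinsupp.lhom_ext fun i a => ?_
    simp
  map_comp_comul := by
    refine DFinsupp.lhom_ext fun i a => ?_
    rw [LinearMap.comp_apply, LinearMap.comp_apply, DFinsupp.comul_single, DFinsupp.lsum_single]
    refine Eq.trans ?_ (CoalgHomClass.map_comp_comul_apply (ψ i) a)
    rw [← LinearMap.comp_apply, ← TensorProduct.map_comp]
    congr 2 <;> (ext a; simp)

/-- Projection to a summand is itself a right action, so right coideals of a direct sum are stable
under all projections. -/
theorem rightAct_counit_comp_lapply (i : ι) (x : Π₀ i, A i) :
    rightAct (Coalgebra.counit ∘ₗ (DFinsupp.lapply i : (Π₀ i, A i) →ₗ[k] A i)) x =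
      DFinsupp.single i (x i) := by
  suffices h : rightAct (Coalgebra.counit ∘ₗ (DFinsupp.lapply i : (Π₀ i, A i) →ₗ[k] A i)) =
      DFinsupp.lsingle i ∘ₗ DFinsupp.lapply i from LinearMap.congr_fun h x
  refine DFinsupp.lhom_ext fun j a => ?_
  refine (rightAct_coalgHom (singleHom k A j) _ a).trans ?_
  rcases eq_or_ne j i with rfl | hne
  · have : (Coalgebra.counit ∘ₗ (DFinsupp.lapply j : (Π₀ i, A i) →ₗ[k] A j)) ∘ₗ
        (singleHom k A j).toLinearMap = Coalgebra.counit := by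
      ext a
      simp [singleHom]
    rw [this, rightAct_counit]
    simp [singleHom]
  · have : (Coalgebra.counit ∘ₗ (DFinsupp.lapply i : (Π₀ i, A i) →ₗ[k] A i)) ∘ₗ
        (singleHom k A j).toLinearMap = 0 := by
      ext a
      simp [singleHom, DFinsupp.single_eq_of_ne hne.symm]
    rw [this]
    simp [rightAct_apply, DFinsupp.single_eq_of_ne hne.symm]

/-- Stability under projections reduces the inclusion to one summand at a time, where the traces of
`L` and `M` are comparable. -/
theorem isDistributiveCoalgebra_dfinsupp (hA : ∀ i, IsChainCoalgebra k (A i)) :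
    IsDistributiveCoalgebra k (Π₀ i, A i) := by
  classical
  rintro ⟨N, hN⟩ ⟨L, hL⟩ ⟨M, hM⟩
  refine le_antisymm ?_ le_inf_sup
  change N ⊓ (L ⊔ M) ≤ (N ⊓ L) ⊔ (N ⊓ M)
  rintro x ⟨hxN, hx⟩
  obtain ⟨l, hl, m, hm, rfl⟩ := Submodule.mem_sup.1 hx
  have hproj : ∀ {K : Submodule k (Π₀ i, A i)}, IsRightCoideal k _ K → ∀ x ∈ K, ∀ i,
      DFinsupp.single i (x i) ∈ K := by
    intro K hK x hx i
    rw [← rightAct_counit_comp_lapply (k := k)]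
    exact isRightCoideal_iff.1 hK _ x hx
  rw [← DFinsupp.sum_single (f := l + m)]
  refine Submodule.sum_mem _ fun i _ => ?_
  have hi := hproj hN _ hxN i
  have hli := hproj hL l hl i
  have hmi := hproj hM m hm i
  have hsum : DFinsupp.single i ((l + m) i) =
      DFinsupp.single i (l i) + DFinsupp.single i (m i) := by
    rw [DFinsupp.add_apply, DFinsupp.single_add]
  rcases le_or_le_of_isChainCoalgebra (hA i)
    (isRightCoideal_comap_coalgHom (singleHom_injective i) hL)
    (isRightCoideal_comap_coalgHom (singleHom_injective i) hM) with h | h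
  · refine Submodule.mem_sup_right ⟨hi, ?_⟩
    rw [hsum]
    exact M.add_mem (h hli) hmi
  · refine Submodule.mem_sup_left ⟨hi, ?_⟩
    rw [hsum]
    exact L.add_mem hli (h hmi)

theorem isDistributiveCoalgebra_of_injective {E : Type*} [AddCommGroup E] [Module k E]
    [Coalgebra k E] {φ : C →ₗc[k] E} (hφ : Function.Injective φ)
    (hE : IsDistributiveCoalgebra k E) : IsDistributiveCoalgebra k C := by
  rintro ⟨N, hN⟩ ⟨L, hL⟩ ⟨M, hM⟩
  refine Subtype.ext (Submodule.map_injective_of_injective (f := φ.toLinearMap) hφ ?_)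
  change Submodule.map _ (N ⊓ (L ⊔ M)) = Submodule.map _ ((N ⊓ L) ⊔ (N ⊓ M))
  rw [Submodule.map_inf _ hφ, Submodule.map_sup, Submodule.map_sup, Submodule.map_inf _ hφ,
    Submodule.map_inf _ hφ]
  exact inf_sup_eq hE ((isRightCoideal_map_coalgHom hφ).2 hN)
    ((isRightCoideal_map_coalgHom hφ).2 hL) ((isRightCoideal_map_coalgHom hφ).2 hM)

end DirectSums

/-! ### Decomposition of a distributive coalgebra into its components -/

section Decomposition

variable {k : Type u} {C : Type v} [Field k] [AddCommGroup C] [Module k C] [Coalgebra k C]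

/-- A distributive coalgebra whose nonzero right coideals contain group-like elements is a direct
sum of subcoalgebras of the divided power coalgebra. -/
theorem exists_equiv_dfinsupp (hC : IsDistributiveCoalgebra k C)
    (hgl : ∀ N : Submodule k C, IsRightCoideal k C N → N ≠ ⊥ → ∃ g ∈ N, IsGroupLikeElem k g) :
    ∃ (ι : Type v) (_ : DecidableEq ι) (S : ι → Subcoalgebra k (DividedPower k)),
      (∀ i, (S i).toSubmodule ≠ ⊥) ∧ Nonempty (C ≃ₗc[k] Π₀ i, (S i).toSubmodule) := by
  classical
  have hS : ∀ g : {g : C // IsGroupLikeElem k g}, ∃ S : Subcoalgebra k (DividedPower k),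
      S.toSubmodule ≠ ⊥ ∧
        Nonempty ((componentSubcoalgebra hC (g : C)).toSubmodule ≃ₗc[k] S.toSubmodule) := by
    intro g
    have hch := isChainCoalgebra_componentSubcoalgebra hC hgl g.2
    exact exists_subcoalgebra_iff.2 ⟨hch.nontrivial, exists_injective_toDividedPower hch
      fun N hN h0 => exists_isGroupLikeElem_subcoalgebra _ hgl hN h0⟩
  choose S hS0 hSe using hS
  let e := fun g => (hSe g).some
  refine ⟨_, inferInstance, S, hS0, ?_⟩
  let Ψ : (Π₀ g, (S g).toSubmodule) →ₗc[k] C := sumHom fun g =>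
    (inclusion (componentSubcoalgebra hC (g : C))).comp (e g).symm.toCoalgHom
  -- Factor `Ψ` as a summandwise isomorphism followed by the sum map of the components; the latter
  -- is injective by independence and surjective because the components span.
  have hΨ : ∀ x, Ψ x = DFinsupp.lsum ℕ (fun g : {g : C // IsGroupLikeElem k g} =>
      (componentSubcoalgebra hC (g : C)).toSubmodule.subtype)
      (DFinsupp.mapRange.linearEquiv (fun g => (e g).symm.toLinearEquiv) x) := by
    intro x
    induction x using DFinsupp.induction with
    | h0 => simp
    | ha g a x _ _ ih =>
      rw [map_add, map_add, map_add, ih]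
      congr 1
  have hbij : Function.Bijective Ψ := by
    have hcoe : ⇑Ψ = (DFinsupp.lsum ℕ fun g : {g : C // IsGroupLikeElem k g} =>
        (componentSubcoalgebra hC (g : C)).toSubmodule.subtype) ∘
        (DFinsupp.mapRange.linearEquiv fun g => (e g).symm.toLinearEquiv) := funext hΨ
    have hind : iSupIndep fun g : {g : C // IsGroupLikeElem k g} =>
        (componentSubcoalgebra hC (g : C)).toSubmodule := iSupIndep_component hC hgl
    have hsup : ⨆ g : {g : C // IsGroupLikeElem k g},
        (componentSubcoalgebra hC (g : C)).toSubmodule = ⊤ := iSup_component hC hgl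
    rw [hcoe]
    refine Function.Bijective.comp ⟨hind.dfinsupp_lsum_injective, fun x => ?_⟩
      (LinearEquiv.bijective _)
    exact (Submodule.mem_iSup_iff_exists_dfinsupp _ x).1 (hsup ▸ Submodule.mem_top)
  exact ⟨(CoalgEquiv.ofBijective hbij).symm⟩

end Decomposition

end RightCoideal

/-! ### The main theorem -/

theorem mainTheorem8 {k : Type u} [Field k] :
    -- pointed chain coalgebras are the nonzero subcoalgebras of the divided power coalgebra
    (∀ (C : Type v) [AddCommGroup C] [Module k C] [Coalgebra k C],
      (IsChainCoalgebra k C ∧ IsPointedCoalgebra k C ↔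
        ∃ S : Subcoalgebra k (DividedPower k), S.toSubmodule ≠ ⊥ ∧
          Nonempty (C ≃ₗc[k] S.toSubmodule))) ∧
    -- these are the duals of truncated polynomial rings and the finite dual of `k⟦X⟧`
    (∀ (C : Type v) [AddCommGroup C] [Module k C] [Coalgebra k C],
      ((∃ S : Subcoalgebra k (DividedPower k), S.toSubmodule ≠ ⊥ ∧
          Nonempty (C ≃ₗc[k] S.toSubmodule)) ↔
        (∃ n : ℕ, 0 < n ∧ Nonempty (C ≃ₗc[k] finiteDual k
          (Polynomial k ⧸ Ideal.span {(Polynomial.X : Polynomial k) ^ n}))) ∨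
        Nonempty (C ≃ₗc[k] finiteDual k (PowerSeries k)))) ∧
    -- over an algebraically closed field
    (IsAlgClosed k →
      ∀ (C : Type v) [AddCommGroup C] [Module k C] [Coalgebra k C],
        (IsChainCoalgebra k C ↔
          ∃ S : Subcoalgebra k (DividedPower k), S.toSubmodule ≠ ⊥ ∧
            Nonempty (C ≃ₗc[k] S.toSubmodule)) ∧
        (IsDistributiveCoalgebra k C ↔
          ∃ (ι : Type v) (_ : DecidableEq ι) (S : ι → Subcoalgebra k (DividedPower k)),
            (∀ i, (S i).toSubmodule ≠ ⊥) ∧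
              Nonempty (C ≃ₗc[k] Π₀ i, (S i).toSubmodule))) := by
  open RightCoideal in
  refine ⟨fun C _ _ _ => ?_, fun C _ _ _ => ?_, fun hk C _ _ _ => ⟨?_, ?_⟩⟩
  · rw [exists_subcoalgebra_iff]
    constructor
    · rintro ⟨hC, hp⟩
      exact ⟨hC.nontrivial, exists_injective_toDividedPower hC fun N hN h0 =>
        exists_isGroupLikeElem_of_pointed hC hp hN h0⟩
    · rintro ⟨hC, φ, hφ⟩
      exact ⟨isChainCoalgebra_of_injective hφ, isPointedCoalgebra_of_injective hφ⟩
  · rw [exists_subcoalgebra_iff, exists_injective_toDividedPower_iff]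
  · rw [exists_subcoalgebra_iff]
    constructor
    · intro hC
      exact ⟨hC.nontrivial, exists_injective_toDividedPower hC fun N hN h0 =>
        exists_isGroupLikeElem_of_isAlgClosed
          (isDistributiveCoalgebra_of_isChainCoalgebra hC) hN h0⟩
    · rintro ⟨hC, φ, hφ⟩
      exact isChainCoalgebra_of_injective hφ
  · constructor
    · intro hC
      exact exists_equiv_dfinsupp hC fun N hN h0 =>
        exists_isGroupLikeElem_of_isAlgClosed hC hN h0
    · rintro ⟨ι, _, S, hS, ⟨e⟩⟩
      refine isDistributiveCoalgebra_of_injective (φ := e.toCoalgHom) e.toEquiv.injective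
        (isDistributiveCoalgebra_dfinsupp fun i => ?_)
      have : Nontrivial (S i).toSubmodule := Submodule.nontrivial_iff_ne_bot.2 (hS i)
      exact isChainCoalgebra_of_injective (inclusion_injective (S i))
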